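/- Fix an integer $N\ge 4$ and reals $\alpha\in\mathbb R$, $0\le x\le 1$. On the space $(\mathbb C^2)^{\otimes N}$ of $N$ qubits consider the state $$\rho_N(x)=x\,|\Psi_G\rangle\langle\Psi_G|+\frac{1-x}{2N}\sum_{k=1}^N\bigl(|u_k\rangle\langle u_k|+|v_k\rangle\langle v_k|\bigr),\qquad |\Psi_G\rangle=\tfrac1{\sqrt2}\bigl(|0\cdots0\rangle+e^{i\alpha}|1\cdots1\rangle\bigr),$$ where $|u_k\rangle$ is the computational basis vector with a $1$ at position $k$ and $0$ elsewhere, and $|v_k\rangle$ the one with a $0$ at position $k$ and $1$ elsewhere (Dür's multipartite states). Logarithms have base $2$. For a state (density matrix) $\rho$ of $N$ parties with finite-dimensional local Hilbert spaces, let $\mathrm{SEP}$ be the set of fully separable states, i.e. of finite convex combinations of products $\sigma^1\otimes\cdots\otimes\sigma^N$ of single-party states. The geometric measure (GM) is $G(\rho)=-2\log\Lambda(\rho)$ with $\Lambda^2(\rho)=\max_{\sigma\in\mathrm{SEP}}\operatorname{tr}(\rho\sigma)$. The relative entropy of entanglement (REE) is $E_R(\rho)=\min_{\sigma\in\mathrm{SEP}}S(\rho\|\sigma)$,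 where $S(\rho\|\sigma)=\operatorname{tr}\rho(\log\rho-\log\sigma)$, understood as $+\infty$ if the support of $\rho$ is not contained in that of $\sigma$. A tensor product $\rho\otimes\sigma$ of two $N$-partite states, or a power $\rho^{\otimes n}$, is regarded as an $N$-partite state whose $j$-th party holds the $j$-th parties of all factors. For $E\in\{G,E_R\}$ put $E^\infty(\rho)=\lim_{n\to\infty}\frac1nE(\rho^{\otimes n})$. $E$ of $\rho$ is called additive if this limit exists and $E^\infty(\rho)=E(\rho)$, and strong additive if $E(\rho\otimes\sigma)=E(\rho)+E(\sigma)$ for every $N$-partite state $\sigma$. **Proposition.** The GM of $\rho_N(x)$ is strong additive and the REE of $\rho_N(x)$ is additive; moreover $$G^\infty[\rho_N(x)]=G[\rho_N(x)]=\begin{cases}-\log\frac{1-x}{2N}, & 0\le x\le\frac1{N+1},\\[2pt] -\log\frac x2, & \frac1{N+1}\le x\le1,\end{cases}\qquad E_R^\infty[\rho_N(x)]=E_R[\rho_N(x)]=x .$$ -/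

import Mathlib

open scoped Topology ComplexOrder

noncomputable section

namespace MultipartiteEntanglement

/-- Density matrices: positive semidefinite with unit trace. -/
def IsState {n : Type} [Fintype n] (ρ : Matrix n n ℂ) : Prop :=
  ρ.PosSemidef ∧ ρ.trace = 1

/-- Operators on `⨂ j, ℂ^(ι j)`, in the computational product basis. -/
abbrev Op {N : ℕ} (ι : Fin N → Type) : Type :=
  Matrix (∀ j, ι j) (∀ j, ι j) ℂ

/-- The product operator `⨂ j, τ j`. -/
def productOp {N : ℕ} {ι : Fin N → Type} (τ : ∀ j, Matrix (ι j) (ι j) ℂ) : Op ι :=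
  Matrix.of fun a b => ∏ j, τ j (a j) (b j)

/-- The fully separable states: finite convex combinations of products of single-party states. -/
def SEP {N : ℕ} (ι : Fin N → Type) [∀ j, Fintype (ι j)] : Set (Op ι) :=
  convexHull ℝ {σ | ∃ τ : ∀ j, Matrix (ι j) (ι j) ℂ, (∀ j, IsState (τ j)) ∧ σ = productOp τ}

/-- The tensor product `ρ ⊗ σ` of two `N`-partite operators, again as an `N`-partite operator:
the `j`-th party of the product holds the `j`-th parties of both factors. -/
def tensor {N : ℕ} {ι κ : Fin N → Type} (ρ : Op ι) (σ : Op κ) : Op (fun j => ι j × κ j) :=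
  Matrix.of fun a b =>
    ρ (fun j => (a j).1) (fun j => (b j).1) * σ (fun j => (a j).2) (fun j => (b j).2)

/-- The `n`-fold tensor power `ρ^{⊗n}` of an `N`-partite operator, again as an `N`-partite
operator: the `j`-th party holds the `j`-th parties of all `n` copies. -/
def tensorPow {N : ℕ} {ι : Fin N → Type} (ρ : Op ι) (n : ℕ) : Op (fun j => Fin n → ι j) :=
  Matrix.of fun a b => ∏ m : Fin n, ρ (fun j => a j m) (fun j => b j m)

/-- The quantum relative entropy `S(ρ‖σ) = tr ρ (log₂ ρ - log₂ σ)` of two states, with the value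
`+∞` when the support of `ρ` is not contained in that of `σ` (i.e. unless `ker σ ⊆ ker ρ`).
The logarithm vanishes on the kernel of its argument, since `Real.logb 2 0 = 0`. -/
def relEntropy {n : Type} [Fintype n] [DecidableEq n] (ρ σ : Matrix n n ℂ) : EReal :=
  open Classical in
  if ∀ v : n → ℂ, σ.mulVec v = 0 → ρ.mulVec v = 0 then
    (((ρ * (cfc (Real.logb 2) ρ - cfc (Real.logb 2) σ)).trace.re : ℝ) : EReal)
  else ⊤

/-- Functionals on operators of `N`-partite systems, for all (finite) local dimensions. -/
abbrev Functional (N : ℕ) : Type 1 :=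
  ∀ (ι : Fin N → Type) [∀ j, Fintype (ι j)] [∀ j, DecidableEq (ι j)], Op ι → EReal

/-- `Λ²(ρ)`, the maximum of `tr (ρ σ)` over fully separable states `σ`. -/
def lambdaSq {N : ℕ} {ι : Fin N → Type} [∀ j, Fintype (ι j)] (ρ : Op ι) : ℝ :=
  sSup ((fun σ : Op ι => (ρ * σ).trace.re) '' SEP ι)

/-- The geometric measure `G(ρ) = -2 log₂ Λ(ρ)`. -/
def GM (N : ℕ) : Functional N :=
  fun _ _ _ ρ => ((-2 * Real.logb 2 (Real.sqrt (lambdaSq ρ)) : ℝ) : EReal)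

/-- The relative entropy of entanglement `E_R(ρ)`, the minimum of `S(ρ‖σ)` over fully separable
states `σ`. -/
def REE (N : ℕ) : Functional N :=
  fun ι _ _ ρ => ⨅ σ ∈ SEP ι, relEntropy ρ σ

/-- `E^∞(ρ) = L`, i.e. the limit of `E(ρ^{⊗n}) / n` exists and equals `L`. -/
def HasRegularization {N : ℕ} (E : Functional N) {ι : Fin N → Type} [∀ j, Fintype (ι j)]
    [∀ j, DecidableEq (ι j)] (ρ : Op ι) (L : EReal) : Prop :=
  Filter.Tendsto (fun n : ℕ => E (fun j => Fin n → ι j) (tensorPow ρ n) / ((n : ℝ) : EReal))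
    Filter.atTop (𝓝 L)

/-- Additivity: `E^∞(ρ) = E(ρ)`. -/
def IsAdditive {N : ℕ} (E : Functional N) {ι : Fin N → Type} [∀ j, Fintype (ι j)]
    [∀ j, DecidableEq (ι j)] (ρ : Op ι) : Prop :=
  HasRegularization E ρ (E ι ρ)

/-- Strong additivity: `E(ρ ⊗ σ) = E(ρ) + E(σ)` for every `N`-partite state `σ`. -/
def IsStrongAdditive {N : ℕ} (E : Functional N) {ι : Fin N → Type} [∀ j, Fintype (ι j)]
    [∀ j, DecidableEq (ι j)] (ρ : Op ι) : Prop :=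
  ∀ (κ : Fin N → Type) [∀ j, Fintype (κ j)] [∀ j, DecidableEq (κ j)] (σ : Op κ), IsState σ →
    E (fun j => ι j × κ j) (tensor ρ σ) = E ι ρ + E κ σ

/-- The operator `|ψ⟩⟨ψ|`. -/
def proj {n : Type} (ψ : n → ℂ) : Matrix n n ℂ :=
  Matrix.vecMulVec ψ (star ψ)

/-- The computational basis vector `|b⟩` of `N` qubits. -/
def ket {N : ℕ} (b : Fin N → Fin 2) : (Fin N → Fin 2) → ℂ :=
  Pi.single b 1

/-- The GHZ vector `(|0…0⟩ + e^{iα} |1…1⟩) / √2`. -/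
def ghz (N : ℕ) (α : ℝ) : (Fin N → Fin 2) → ℂ :=
  (((1 / Real.sqrt 2 : ℝ)) : ℂ) •
    (ket (fun _ => 0) + Complex.exp (α * Complex.I) • ket (fun _ => 1))

/-- `|u_k⟩`: the `k`-th qubit is `1`, all others are `0`. -/
def uVec {N : ℕ} (k : Fin N) : (Fin N → Fin 2) → ℂ :=
  ket (Function.update (fun _ => 0) k 1)

/-- `|v_k⟩`: the `k`-th qubit is `0`, all others are `1`. -/
def vVec {N : ℕ} (k : Fin N) : (Fin N → Fin 2) → ℂ :=
  ket (Function.update (fun _ => 1) k 0)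

/-- The family `ρ_N(x) = x |Ψ_G⟩⟨Ψ_G| + (1 - x)/(2N) ∑ₖ (|u_k⟩⟨u_k| + |v_k⟩⟨v_k|)`. -/
def durState (N : ℕ) (α x : ℝ) : Op (fun _ : Fin N => Fin 2) :=
  (x : ℂ) • proj (ghz N α) +
    (((1 - x) / (2 * N) : ℝ) : ℂ) • ∑ k : Fin N, (proj (uVec k) + proj (vVec k))

end MultipartiteEntanglement

end

/-!
If the entries of `ρ` are dominated by those of `M`, that is `|ρ_ab| ≤ M_ab`, and
`Λ²(M) = Λ²(ρ)`, then `Λ²(ρ ⊗ σ) = Λ²(ρ) Λ²(σ)` for every `σ`. In the expectation value of `ρ ⊗ σ`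
at a product vector, the Cauchy–Schwarz inequality for `σ` bounds the coefficient of `ρ_ab` by
`Λ²(σ)` times a product of norms of local vectors, and after replacing `ρ_ab` by `M_ab` what remains
is the expectation value of `M` at a product vector. For `A |Ψ_G⟩⟨Ψ_G| + C ∑ₖ (|u_k⟩⟨u_k| +
|v_k⟩⟨v_k|)` the dominating `M` is the operator with `α = 0`.

The value `Λ² = max (A / 2) C` of these operators comes from an exchange argument. For a unit
product vector with coefficients `c`, exchanging the bits of `0…0` and `1…1` at two positions gives
complementary strings `p`, `q` with `c_p c_q = c_{0…0} c_{1…1}`. For `N ≥ 4` they differ from all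
strings occurring in the state, so the AM-GM inequality lets `|c_p|² + |c_q|²` pay for the GHZ
coherence, and `(|c_{0…0}| + |c_{1…1}|)² + ∑ₖ (|c_{u_k}|² + |c_{v_k}|²) ≤ 1`.

For the relative entropy of entanglement, a positive `Γ` with eigenvectors `e i`, eigenvalues `w i`
and `Λ²(Γ) ≤ 1` yields `S(ρ‖σ) ≥ ∑ p i log (w i)` for `ρ = ∑ p i |e i⟩⟨e i|` and separable `σ`, by
Gibbs' inequality. The choice `A = 2`, `C = 1` gives the lower bound `x`, which the diagonal part of
`ρ` attains. Both sides are compatible with tensor powers because `Λ²` is multiplicative on `Γ`.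
-/

namespace MultipartiteEntanglement

open Matrix Finset

section Mixture

variable {n κ : Type}

/-- The mixture `∑ i, p i |e i⟩⟨e i|` of pure states. Neither normalization of the weights nor
orthonormality of the vectors is built in. -/
noncomputable def mixture [Fintype κ] (p : κ → ℝ) (e : κ → n → ℂ) : Matrix n n ℂ :=
  ∑ i, (p i : ℂ) • proj (e i)

theorem posSemidef_mixture [Finite n] [Fintype κ] {p : κ → ℝ} (hp : ∀ i, 0 ≤ p i)
    (e : κ → n → ℂ) : (mixture p e).PosSemidef :=
  posSemidef_sum _ fun i _ =>
    (posSemidef_vecMulVec_self_star (e i)).smul (Complex.zero_le_real.mpr (hp i))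

variable [Fintype n]

theorem orthonormal_toLp_iff [DecidableEq κ] {e : κ → n → ℂ} :
    Orthonormal ℂ (fun i => WithLp.toLp 2 (e i)) ↔
      ∀ i j, star (e i) ⬝ᵥ e j = if i = j then 1 else 0 := by
  simp only [orthonormal_iff_ite, EuclideanSpace.inner_toLp_toLp, dotProduct_comm]

theorem star_dotProduct_mulVec_of_eigenvector {A : Matrix n n ℂ} (hA : A.IsHermitian)
    {v : n → ℂ} {c : ℝ} (hv : A *ᵥ v = (c : ℂ) • v) (w : n → ℂ) :
    star v ⬝ᵥ A *ᵥ w = c * (star v ⬝ᵥ w) := by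
  rw [dotProduct_mulVec, ← hA.eq, ← star_mulVec, hv, star_smul, smul_dotProduct]
  simp

theorem star_dotProduct_eq_zero_of_mulVec_eq_zero {A : Matrix n n ℂ} (hA : A.IsHermitian)
    {v w : n → ℂ} {c : ℝ} (hv : A *ᵥ v = (c : ℂ) • v) (hc : c ≠ 0) (hw : A *ᵥ w = 0) :
    star v ⬝ᵥ w = 0 := by
  have h := star_dotProduct_mulVec_of_eigenvector hA hv w
  rw [hw, dotProduct_zero, eq_comm, mul_eq_zero, Complex.ofReal_eq_zero] at h
  exact h.resolve_left hc

variable [Fintype κ]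

theorem proj_mulVec (ψ v : n → ℂ) : proj ψ *ᵥ v = (star ψ ⬝ᵥ v) • ψ := by
  rw [proj, vecMulVec_mulVec, op_smul_eq_smul]

theorem mixture_mulVec (p : κ → ℝ) (e : κ → n → ℂ) (v : n → ℂ) :
    mixture p e *ᵥ v = ∑ i, (p i * (star (e i) ⬝ᵥ v)) • e i := by
  simp only [mixture, sum_mulVec, smul_mulVec, proj_mulVec, smul_smul]

theorem trace_mul_proj (B : Matrix n n ℂ) (ψ : n → ℂ) :
    (B * proj ψ).trace = star ψ ⬝ᵥ B *ᵥ ψ := by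
  rw [proj, mul_vecMulVec, trace_vecMulVec, dotProduct_comm]

theorem trace_mixture_mul (p : κ → ℝ) (e : κ → n → ℂ) (B : Matrix n n ℂ) :
    (mixture p e * B).trace = ∑ i, (p i : ℂ) * (star (e i) ⬝ᵥ B *ᵥ e i) := by
  simp only [trace_mul_comm _ B, mixture, mul_sum, trace_sum, Matrix.mul_smul, trace_smul,
    trace_mul_proj, smul_eq_mul]

theorem dotProduct_mixture_mulVec (p : κ → ℝ) (e : κ → n → ℂ) (v : n → ℂ) :
    star v ⬝ᵥ mixture p e *ᵥ v = ((∑ i, p i * ‖star (e i) ⬝ᵥ v‖ ^ 2 : ℝ) : ℂ) := by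
  rw [mixture_mulVec, dotProduct_sum, Complex.ofReal_sum]
  refine sum_congr rfl fun i _ => ?_
  rw [dotProduct_smul, smul_eq_mul, mul_assoc, star_dotProduct v, Complex.star_def,
    Complex.mul_conj', Complex.ofReal_mul, Complex.ofReal_pow]

theorem mixture_mulVec_self {e : κ → n → ℂ} (he : Orthonormal ℂ fun i => WithLp.toLp 2 (e i))
    (p : κ → ℝ) (i : κ) : mixture p e *ᵥ e i = (p i : ℂ) • e i := by
  classical
  rw [mixture_mulVec, sum_eq_single i]
  · rw [orthonormal_toLp_iff.mp he, if_pos rfl, mul_one]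
  · intro j _ hj
    rw [orthonormal_toLp_iff.mp he, if_neg hj, mul_zero, zero_smul]
  · simp

theorem trace_mixture {e : κ → n → ℂ} (he : ∀ i, star (e i) ⬝ᵥ e i = 1) (p : κ → ℝ) :
    (mixture p e).trace = ((∑ i, p i : ℝ) : ℂ) := by
  classical
  simpa only [mul_one, one_mulVec, he, Complex.ofReal_sum] using trace_mixture_mul p e 1

theorem isState_mixture {p : κ → ℝ} (hp : ∀ i, 0 ≤ p i) (hp1 : ∑ i, p i = 1) {e : κ → n → ℂ}
    (he : ∀ i, star (e i) ⬝ᵥ e i = 1) : IsState (mixture p e) :=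
  ⟨posSemidef_mixture hp e, by rw [trace_mixture he, hp1, Complex.ofReal_one]⟩

variable [DecidableEq n] {A : Matrix n n ℂ}

theorem cfc_eq_mixture (hA : A.IsHermitian) (f : ℝ → ℝ) :
    cfc f A = mixture (fun i => f (hA.eigenvalues i)) fun i => ⇑(hA.eigenvectorBasis i) := by
  rw [hA.cfc_eq, IsHermitian.cfc, Unitary.conjStarAlgAut_apply, star_eq_conjTranspose]
  ext a b
  rw [mul_apply]
  simp only [mixture, proj, mul_diagonal, conjTranspose_apply,
    Matrix.sum_apply, Matrix.smul_apply,
    IsHermitian.eigenvectorUnitary_apply, vecMulVec_apply, Pi.star_apply, smul_eq_mul,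
    Function.comp_apply, Complex.coe_algebraMap]
  exact sum_congr rfl fun i _ => by ring

theorem mixture_eigenvalues (hA : A.IsHermitian) :
    mixture hA.eigenvalues (fun i => ⇑(hA.eigenvectorBasis i)) = A := by
  rw [← cfc_eq_mixture hA fun x => x, cfc_id' (p := IsSelfAdjoint) ℝ A hA]

theorem mixture_one_eigenvectorBasis (hA : A.IsHermitian) :
    mixture 1 (fun i => ⇑(hA.eigenvectorBasis i)) = 1 := by
  rw [← cfc_const_one (p := IsSelfAdjoint) ℝ A hA, cfc_eq_mixture hA]
  simp only [Pi.one_def]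

theorem star_dotProduct_eigenvectorBasis_self (hA : A.IsHermitian) (i : n) :
    star ⇑(hA.eigenvectorBasis i) ⬝ᵥ hA.eigenvectorBasis i = (1 : ℂ) :=
  (orthonormal_toLp_iff.mp hA.eigenvectorBasis.orthonormal i i).trans (if_pos rfl)

theorem cfc_mulVec_of_eigenvector (hA : A.IsHermitian) {v : n → ℂ} {c : ℝ}
    (hv : A *ᵥ v = (c : ℂ) • v) (f : ℝ → ℝ) : cfc f A *ᵥ v = (f c : ℂ) • v := by
  set e : n → n → ℂ := fun i => ⇑(hA.eigenvectorBasis i)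
  have he (i) : A *ᵥ e i = (hA.eigenvalues i : ℂ) • e i := hA.mulVec_eigenvectorBasis i
  have hc (i) : (hA.eigenvalues i : ℂ) * (star (e i) ⬝ᵥ v) = c * (star (e i) ⬝ᵥ v) := by
    rw [← star_dotProduct_mulVec_of_eigenvector hA (he i), hv,
      dotProduct_smul, smul_eq_mul]
  have hfc (i) : (f (hA.eigenvalues i) : ℂ) * (star (e i) ⬝ᵥ v) = f c * (star (e i) ⬝ᵥ v) := by
    rcases mul_eq_mul_right_iff.mp (hc i) with h | h
    · rw [Complex.ofReal_inj.mp h]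
    · rw [h, mul_zero, mul_zero]
  calc cfc f A *ᵥ v = (f c : ℂ) • mixture 1 e *ᵥ v := by
        simp only [cfc_eq_mixture hA, mixture_mulVec, hfc, smul_sum, smul_smul, Pi.one_apply,
          Complex.ofReal_one, one_mul, e]
    _ = (f c : ℂ) • v := by rw [mixture_one_eigenvectorBasis, one_mulVec]

end Mixture

section RelEntropy

variable {n κ : Type} [Fintype κ]

theorem sum_mul_logb_le {t s : κ → ℝ} (ht : ∀ i, 0 ≤ t i) (ht1 : ∑ i, t i = 1)
    (hs : ∀ i, 0 ≤ s i) (hts : ∀ i, s i = 0 → t i = 0) :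
    ∑ i, t i * Real.logb 2 (s i) ≤ Real.logb 2 (∑ i, t i * s i) := by
  obtain ⟨j, -, hj⟩ : ∃ j ∈ univ, t j ≠ 0 := exists_ne_zero_of_sum_ne_zero (by simp [ht1])
  have hS : 0 < ∑ i, t i * s i :=
    sum_pos' (fun i _ => mul_nonneg (ht i) (hs i)) ⟨j, mem_univ j,
      mul_pos ((ht j).lt_of_ne' hj) ((hs j).lt_of_ne' fun h => hj (hts j h))⟩
  set S := ∑ i, t i * s i with hSdef
  have tangent (i) : t i * Real.log (s i) ≤ t i * Real.log S + (t i * s i / S - t i) := by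
    rcases (hs i).eq_or_lt with h | h
    · simp [hts i h.symm]
    · have := Real.log_le_sub_one_of_pos (div_pos h hS)
      rw [Real.log_div h.ne' hS.ne'] at this
      linear_combination mul_le_mul_of_nonneg_left this (ht i)
  have hlog : ∑ i, t i * Real.log (s i) ≤ Real.log S :=
    calc ∑ i, t i * Real.log (s i) ≤ ∑ i, (t i * Real.log S + (t i * s i / S - t i)) :=
          sum_le_sum fun i _ => tangent i
      _ = Real.log S := by
          rw [sum_add_distrib, sum_sub_distrib, ← sum_mul, ← sum_div, ht1, ← hSdef,
            div_self hS.ne', sub_self, one_mul, add_zero]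
  simpa only [Real.logb, mul_div_assoc', ← sum_div] using
    div_le_div_of_nonneg_right hlog (Real.log_pos one_lt_two).le

theorem sum_mul_logb_le_sum_mul_logb_self {p r : κ → ℝ} (hp : ∀ i, 0 ≤ p i) (hp1 : ∑ i, p i = 1)
    (hr : ∀ i, 0 ≤ r i) (hr1 : ∑ i, r i ≤ 1) (hrp : ∀ i, r i = 0 → p i = 0) :
    ∑ i, p i * Real.logb 2 (r i) ≤ ∑ i, p i * Real.logb 2 (p i) := by
  have hdiv (i) : r i / p i = 0 → p i = 0 := fun h => (div_eq_zero_iff.mp h).elim (hrp i) id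
  have hratio (i) : p i * (r i / p i) ≤ r i := by
    rcases eq_or_ne (p i) 0 with h | h
    · rw [h, zero_mul]; exact hr i
    · rw [mul_div_cancel₀ _ h]
  have hnonneg (i) : 0 ≤ r i / p i := div_nonneg (hr i) (hp i)
  have hlog (i) : p i * Real.logb 2 (r i / p i) =
      p i * Real.logb 2 (r i) - p i * Real.logb 2 (p i) := by
    rcases eq_or_ne (p i) 0 with h | h
    · simp [h]
    · rw [Real.logb_div (fun h' => h (hrp i h')) h, mul_sub]
  have hle : ∑ i, p i * Real.logb 2 (r i / p i) ≤ 0 :=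
    (sum_mul_logb_le hp hp1 hnonneg hdiv).trans <| Real.logb_nonpos one_lt_two
      (sum_nonneg fun i _ => mul_nonneg (hp i) (hnonneg i))
      ((sum_le_sum fun i _ => hratio i).trans hr1)
  simpa only [hlog, sum_sub_distrib, sub_nonpos] using hle

variable [Fintype n] [DecidableEq n]

theorem re_dotProduct_cfc_logb_mulVec_le {σ : Matrix n n ℂ} (hσ : σ.PosSemidef) {v : n → ℂ}
    (hv : star v ⬝ᵥ v = 1) (hker : ∀ w, σ *ᵥ w = 0 → star w ⬝ᵥ v = 0) :
    (star v ⬝ᵥ cfc (Real.logb 2) σ *ᵥ v).re ≤ Real.logb 2 (star v ⬝ᵥ σ *ᵥ v).re := by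
  have hH := hσ.isHermitian
  set e : n → n → ℂ := fun i => ⇑(hH.eigenvectorBasis i)
  have hσe (i) : σ *ᵥ e i = (hH.eigenvalues i : ℂ) • e i := hH.mulVec_eigenvectorBasis i
  have hexp (p : n → ℝ) : (star v ⬝ᵥ mixture p e *ᵥ v).re = ∑ i, ‖star (e i) ⬝ᵥ v‖ ^ 2 * p i := by
    rw [dotProduct_mixture_mulVec, Complex.ofReal_re]
    exact sum_congr rfl fun i _ => mul_comm _ _
  have hone : ∑ i, ‖star (e i) ⬝ᵥ v‖ ^ 2 = 1 := by
    simpa only [mixture_one_eigenvectorBasis hH, one_mulVec, hv, Complex.one_re, Pi.one_apply,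
      mul_one, e] using (hexp 1).symm
  have hσv := hexp hH.eigenvalues
  rw [mixture_eigenvalues hH] at hσv
  rw [cfc_eq_mixture hH, hexp, hσv]
  refine sum_mul_logb_le (fun i => by positivity) hone hσ.eigenvalues_nonneg fun i hi => ?_
  rw [hker (e i) (by rw [hσe, hi, Complex.ofReal_zero, zero_smul]), norm_zero, sq, zero_mul]

variable {e : κ → n → ℂ} {p : κ → ℝ}

theorem relEntropy_mixture (he : Orthonormal ℂ fun i => WithLp.toLp 2 (e i)) {σ : Matrix n n ℂ}
    (hp : ∀ i, 0 ≤ p i) (hker : ∀ v, σ *ᵥ v = 0 → mixture p e *ᵥ v = 0) :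
    relEntropy (mixture p e) σ = ((∑ i, p i * (Real.logb 2 (p i) -
      (star (e i) ⬝ᵥ cfc (Real.logb 2) σ *ᵥ e i).re) : ℝ) : EReal) := by
  classical
  have hH : (mixture p e).IsHermitian := (posSemidef_mixture hp e).isHermitian
  rw [relEntropy, if_pos hker, trace_mixture_mul, Complex.re_sum, EReal.coe_eq_coe_iff]
  refine sum_congr rfl fun i _ => ?_
  rw [sub_mulVec, dotProduct_sub, cfc_mulVec_of_eigenvector hH (mixture_mulVec_self he p i),
    dotProduct_smul, orthonormal_toLp_iff.mp he, if_pos rfl, smul_eq_mul, mul_one,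
    Complex.re_ofReal_mul, Complex.sub_re, Complex.ofReal_re]

theorem relEntropy_mixture_of_eigenvectors (he : Orthonormal ℂ fun i => WithLp.toLp 2 (e i))
    (hp : ∀ i, 0 ≤ p i) {σ : Matrix n n ℂ} (hσ : σ.IsHermitian) {s : κ → ℝ}
    (hσe : ∀ i, σ *ᵥ e i = (s i : ℂ) • e i) (hs : ∀ i, s i = 0 → p i = 0) :
    relEntropy (mixture p e) σ =
      ((∑ i, p i * (Real.logb 2 (p i) - Real.logb 2 (s i)) : ℝ) : EReal) := by
  classical
  rw [relEntropy_mixture he hp]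
  · simp only [cfc_mulVec_of_eigenvector hσ (hσe _), dotProduct_smul,
      orthonormal_toLp_iff.mp he, if_true, smul_eq_mul, mul_one, Complex.ofReal_re]
  · intro v hv
    rw [mixture_mulVec]
    refine sum_eq_zero fun i _ => ?_
    rcases eq_or_ne (s i) 0 with h | h
    · rw [hs i h, Complex.ofReal_zero, zero_mul, zero_smul]
    · rw [star_dotProduct_eq_zero_of_mulVec_eq_zero hσ (hσe i) h hv, mul_zero, zero_smul]

theorem sum_mul_logb_le_relEntropy {w : κ → ℝ}
    (he : Orthonormal ℂ fun i => WithLp.toLp 2 (e i)) (hp : ∀ i, 0 ≤ p i) (hp1 : ∑ i, p i = 1)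
    (hw : ∀ i, 0 < w i) {σ : Matrix n n ℂ} (hσ : σ.PosSemidef)
    (hwσ : (mixture w e * σ).trace.re ≤ 1) :
    ((∑ i, p i * Real.logb 2 (w i) : ℝ) : EReal) ≤ relEntropy (mixture p e) σ := by
  classical
  by_cases hker : ∀ v, σ *ᵥ v = 0 → mixture p e *ᵥ v = 0
  swap
  · rw [relEntropy, if_neg hker]; exact le_top
  have hperp (i) (hi : p i ≠ 0) (v) (hv : σ *ᵥ v = 0) : star v ⬝ᵥ e i = 0 := by
    rw [star_dotProduct, star_dotProduct_eq_zero_of_mulVec_eq_zero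
      (posSemidef_mixture hp e).isHermitian (mixture_mulVec_self he p i) hi (hker v hv), star_zero]
  have hunit (i) : star (e i) ⬝ᵥ e i = 1 := (orthonormal_toLp_iff.mp he i i).trans (if_pos rfl)
  set q : κ → ℝ := fun i => (star (e i) ⬝ᵥ σ *ᵥ e i).re
  have hq0 (i) : 0 ≤ q i := hσ.re_dotProduct_nonneg (e i)
  have hqp (i) (hi : p i ≠ 0) : q i ≠ 0 := fun h => by
    have hzero : star (e i) ⬝ᵥ σ *ᵥ e i = 0 :=
      Complex.ext h (Complex.nonneg_iff.mp (hσ.dotProduct_mulVec_nonneg (e i))).2.symm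
    have := hperp i hi (e i) ((hσ.dotProduct_mulVec_zero_iff _).mp hzero)
    exact one_ne_zero ((hunit i).symm.trans this)
  have hwq : ∑ i, w i * q i ≤ 1 := by
    simpa only [trace_mixture_mul, Complex.re_sum, Complex.re_ofReal_mul] using hwσ
  have gibbs := sum_mul_logb_le_sum_mul_logb_self (r := fun i => w i * q i) hp hp1
    (fun i => mul_nonneg (hw i).le (hq0 i)) hwq fun i hi =>
      of_not_not fun h => mul_ne_zero (hw i).ne' (hqp i h) hi
  have hterm (i) : p i * Real.logb 2 (w i) + p i * (star (e i) ⬝ᵥ cfc (Real.logb 2) σ *ᵥ e i).re ≤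
      p i * Real.logb 2 (w i * q i) := by
    rcases eq_or_ne (p i) 0 with h | h
    · simp [h]
    · rw [← mul_add, Real.logb_mul (hw i).ne' (hqp i h)]
      gcongr
      · exact hp i
      · exact re_dotProduct_cfc_logb_mulVec_le hσ (hunit i) (hperp i h)
  rw [relEntropy_mixture he hp hker, EReal.coe_le_coe_iff]
  have := sum_le_sum fun i (_ : i ∈ univ) => hterm i
  simp only [mul_sub, sum_sub_distrib, sum_add_distrib] at this ⊢
  linarith

end RelEntropy

section States

theorem star_dotProduct_self {n : Type} [Fintype n] (v : n → ℂ) :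
    star v ⬝ᵥ v = ((∑ i, ‖v i‖ ^ 2 : ℝ) : ℂ) := by
  simp only [dotProduct, Pi.star_apply, Complex.star_def, Complex.conj_mul', Complex.ofReal_sum,
    Complex.ofReal_pow]

theorem star_dotProduct_self_eq_one_iff {n : Type} [Fintype n] {v : n → ℂ} :
    star v ⬝ᵥ v = 1 ↔ ∑ i, ‖v i‖ ^ 2 = 1 := by
  rw [star_dotProduct_self, Complex.ofReal_eq_one]

theorem IsState.exists_mixture {n : Type} [Fintype n] {τ : Matrix n n ℂ} (hτ : IsState τ) :
    ∃ (p : n → ℝ) (e : n → n → ℂ), (∀ i, 0 ≤ p i) ∧ ∑ i, p i = 1 ∧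
      (∀ i, star (e i) ⬝ᵥ e i = 1) ∧ τ = mixture p e := by
  classical
  have hH := hτ.1.isHermitian
  have hunit := star_dotProduct_eigenvectorBasis_self hH
  refine ⟨hH.eigenvalues, _, hτ.1.eigenvalues_nonneg, ?_, hunit, (mixture_eigenvalues hH).symm⟩
  rw [← Complex.ofReal_eq_one, ← trace_mixture hunit, mixture_eigenvalues, hτ.2]

theorem mixture_mem_of_convex {n κ : Type} [Fintype κ] {s : Set (Matrix n n ℂ)} (hs : Convex ℝ s)
    {p : κ → ℝ} (hp : ∀ i, 0 ≤ p i) (hp1 : ∑ i, p i = 1) {e : κ → n → ℂ}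
    (he : ∀ i, proj (e i) ∈ s) : mixture p e ∈ s :=
  hs.sum_mem (fun i _ => hp i) hp1 fun i _ => he i

theorem norm_mixture_apply_le {n κ : Type} [Fintype κ] {p : κ → ℝ}
    (hp : ∀ i, 0 ≤ p i) {e e' : κ → n → ℂ} (he : ∀ i a, e' i a = (‖e i a‖ : ℂ)) (a b : n) :
    ‖mixture p e a b‖ ≤ (mixture p e' a b).re := by
  simp only [mixture, proj, Matrix.sum_apply, Matrix.smul_apply, vecMulVec_apply, Pi.star_apply,
    smul_eq_mul, he, Complex.star_def, Complex.conj_ofReal, Complex.re_sum, Complex.re_ofReal_mul,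
    Complex.ofReal_re]
  refine (norm_sum_le _ _).trans_eq (sum_congr rfl fun i _ => ?_)
  rw [norm_mul, norm_mul, Complex.norm_of_nonneg (hp i), Complex.norm_conj]

end States

section Product

variable {N : ℕ} {ι κ : Fin N → Type}

/-- The product vector `⨂ j, ψ j`. -/
def prodVec (ψ : ∀ j, ι j → ℂ) : (∀ j, ι j) → ℂ := fun a => ∏ j, ψ j (a j)

theorem productOp_proj (ψ : ∀ j, ι j → ℂ) : productOp (fun j => proj (ψ j)) = proj (prodVec ψ) := by
  ext a b
  simp only [productOp, proj, prodVec, of_apply, vecMulVec_apply, Pi.star_apply, star_prod,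
    prod_mul_distrib]

theorem prodVec_smul (c : Fin N → ℂ) (ψ : ∀ j, ι j → ℂ) :
    prodVec (fun j => c j • ψ j) = (∏ j, c j) • prodVec ψ := by
  ext a
  simp only [prodVec, Pi.smul_apply, smul_eq_mul, prod_mul_distrib]

theorem prodVec_single [∀ j, DecidableEq (ι j)] (a : ∀ j, ι j) :
    prodVec (fun j => (Pi.single (a j) 1 : ι j → ℂ)) = Pi.single a 1 := by
  ext b
  simp only [prodVec, Pi.single_apply, prod_ite_zero, prod_const_one, mem_univ, forall_const,
    funext_iff]

theorem productOp_mixture [∀ j, Fintype (κ j)] (p : ∀ j, κ j → ℝ) (e : ∀ j, κ j → ι j → ℂ) :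
    productOp (fun j => mixture (p j) (e j)) =
      mixture (fun k : ∀ j, κ j => ∏ j, p j (k j)) fun k => prodVec fun j => e j (k j) := by
  ext a b
  simp only [productOp, mixture, of_apply, Matrix.sum_apply, Matrix.smul_apply, ← productOp_proj,
    prod_univ_sum, Fintype.piFinset_univ, prod_mul_distrib, smul_eq_mul, Complex.ofReal_prod]

variable [∀ j, Fintype (ι j)]

theorem star_prodVec_dotProduct (ψ φ : ∀ j, ι j → ℂ) :
    star (prodVec ψ) ⬝ᵥ prodVec φ = ∏ j, star (ψ j) ⬝ᵥ φ j := by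
  simp only [dotProduct, prod_univ_sum, Fintype.piFinset_univ, prodVec, Pi.star_apply, star_prod,
    prod_mul_distrib]

theorem SEP_eq_convexHull_proj :
    SEP ι = convexHull ℝ
      {σ | ∃ ψ : ∀ j, ι j → ℂ, (∀ j, ∑ i, ‖ψ j i‖ ^ 2 = 1) ∧ σ = proj (prodVec ψ)} := by
  apply subset_antisymm
  · refine convexHull_min ?_ (convex_convexHull ℝ _)
    rintro _ ⟨τ, hτ, rfl⟩
    choose p e hp hp1 he hτe using fun j => (hτ j).exists_mixture
    rw [funext hτe, productOp_mixture]
    refine mixture_mem_of_convex (convex_convexHull ℝ _) (fun k => prod_nonneg fun j _ => hp j _)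
      ?_ fun k => subset_convexHull ℝ _
        ⟨_, fun j => star_dotProduct_self_eq_one_iff.mp (he j (k j)), rfl⟩
    rw [← Fintype.piFinset_univ, ← prod_univ_sum, prod_eq_one fun j _ => hp1 j]
  · refine convexHull_mono ?_
    rintro _ ⟨ψ, hψ, rfl⟩
    refine ⟨_, fun j => ⟨posSemidef_vecMulVec_self_star (ψ j), ?_⟩, (productOp_proj ψ).symm⟩
    exact (trace_vecMulVec _ _).trans <|
      (dotProduct_comm _ _).trans <| star_dotProduct_self_eq_one_iff.mpr (hψ j)

theorem proj_prodVec_mem_SEP {ψ : ∀ j, ι j → ℂ} (hψ : ∀ j, ∑ i, ‖ψ j i‖ ^ 2 = 1) :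
    proj (prodVec ψ) ∈ SEP ι :=
  SEP_eq_convexHull_proj (ι := ι) ▸ subset_convexHull ℝ _ ⟨ψ, hψ, rfl⟩

theorem posSemidef_of_mem_SEP {σ : Op ι} (hσ : σ ∈ SEP ι) : σ.PosSemidef := by
  rw [SEP_eq_convexHull_proj] at hσ
  have hconv : Convex ℝ {σ : Op ι | σ.PosSemidef} := fun x hx y hy a b ha hb _ =>
    (PosSemidef.smul hx ha).add (PosSemidef.smul hy hb)
  refine convexHull_min ?_ hconv hσ
  rintro _ ⟨ψ, -, rfl⟩
  exact posSemidef_vecMulVec_self_star _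

end Product

section LambdaSq

variable {N : ℕ} {ι κ : Fin N → Type} [∀ j, Fintype (ι j)] [∀ j, Fintype (κ j)]

theorem re_trace_mul_le_of_mem_SEP {M : Op ι} {L : ℝ}
    (hL : ∀ ψ : ∀ j, ι j → ℂ, (∀ j, ∑ i, ‖ψ j i‖ ^ 2 = 1) →
      (star (prodVec ψ) ⬝ᵥ M *ᵥ prodVec ψ).re ≤ L)
    {σ : Op ι} (hσ : σ ∈ SEP ι) : (M * σ).trace.re ≤ L := by
  rw [SEP_eq_convexHull_proj] at hσ
  have hlin : IsLinearMap ℝ fun σ : Op ι => (M * σ).trace.re :=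
    ⟨fun σ τ => by simp [Matrix.mul_add], fun c σ => by simp⟩
  refine convexHull_min ?_ (convex_halfSpace_le hlin L) hσ
  rintro _ ⟨ψ, hψ, rfl⟩
  rw [Set.mem_ofPred_eq, trace_mul_proj]
  exact hL ψ hψ

theorem lambdaSq_le {M : Op ι} {L : ℝ} (hL0 : 0 ≤ L)
    (hL : ∀ ψ : ∀ j, ι j → ℂ, (∀ j, ∑ i, ‖ψ j i‖ ^ 2 = 1) →
      (star (prodVec ψ) ⬝ᵥ M *ᵥ prodVec ψ).re ≤ L) : lambdaSq M ≤ L := by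
  refine Real.sSup_le ?_ hL0
  rintro _ ⟨σ, hσ, rfl⟩
  exact re_trace_mul_le_of_mem_SEP hL hσ

theorem lambdaSq_mul_le {M : Op ι} {q L : ℝ} (hq : 0 ≤ q) (hL0 : 0 ≤ L)
    (hL : ∀ ψ : ∀ j, ι j → ℂ, (∀ j, ∑ i, ‖ψ j i‖ ^ 2 = 1) →
      (star (prodVec ψ) ⬝ᵥ M *ᵥ prodVec ψ).re * q ≤ L) : lambdaSq M * q ≤ L := by
  rcases hq.eq_or_lt with rfl | hq
  · rwa [mul_zero]
  · rw [← le_div_iff₀ hq]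
    exact lambdaSq_le (div_nonneg hL0 hq.le) fun ψ hψ => (le_div_iff₀ hq).mpr (hL ψ hψ)

theorem norm_apply_le_one_of_sum_sq {n : Type} [Fintype n] {v : n → ℂ}
    (hv : ∑ i, ‖v i‖ ^ 2 = 1) (i : n) : ‖v i‖ ≤ 1 :=
  (sq_le_one_iff₀ (norm_nonneg _)).mp <|
    hv ▸ single_le_sum (f := fun i => ‖v i‖ ^ 2) (fun _ _ => by positivity) (mem_univ i)

theorem bddAbove_re_trace_mul (M : Op ι) :
    BddAbove ((fun σ : Op ι => (M * σ).trace.re) '' SEP ι) := by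
  refine ⟨∑ a, ∑ b, ‖M a b‖, ?_⟩
  rintro _ ⟨σ, hσ, rfl⟩
  refine re_trace_mul_le_of_mem_SEP (fun ψ hψ => ?_) hσ
  have hψ1 (a) : ‖prodVec ψ a‖ ≤ 1 := by
    rw [prodVec, norm_prod]
    exact prod_le_one (fun _ _ => norm_nonneg _) fun j _ => norm_apply_le_one_of_sum_sq (hψ j) _
  refine (Complex.re_le_norm _).trans <| (norm_sum_le _ _).trans <| sum_le_sum fun a _ => ?_
  rw [norm_mul, Pi.star_apply, norm_star]
  refine (mul_le_of_le_one_left (norm_nonneg _) (hψ1 a)).trans <|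
    (norm_sum_le _ _).trans <| sum_le_sum fun b _ => ?_
  rw [norm_mul]
  exact mul_le_of_le_one_right (norm_nonneg _) (hψ1 b)

theorem re_trace_mul_le_lambdaSq (M : Op ι) {σ : Op ι} (hσ : σ ∈ SEP ι) :
    (M * σ).trace.re ≤ lambdaSq M :=
  le_csSup (bddAbove_re_trace_mul M) (Set.mem_image_of_mem _ hσ)

theorem exists_unit_eq_smul {n : Type} [Fintype n] {v : n → ℂ} (hv : ∑ i, ‖v i‖ ^ 2 ≠ 0) :
    ∃ u : n → ℂ, ∑ i, ‖u i‖ ^ 2 = 1 ∧ v = (√(∑ i, ‖v i‖ ^ 2) : ℂ) • u := by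
  have hnonneg : 0 ≤ ∑ i, ‖v i‖ ^ 2 := sum_nonneg fun _ _ => by positivity
  refine ⟨(√(∑ i, ‖v i‖ ^ 2) : ℂ)⁻¹ • v, ?_, (smul_inv_smul₀ ?_ v).symm⟩
  · simp only [Pi.smul_apply, smul_eq_mul, norm_mul, norm_inv, Complex.norm_real, mul_pow,
      ← mul_sum, inv_pow, Real.norm_eq_abs, sq_abs, Real.sq_sqrt hnonneg]
    exact inv_mul_cancel₀ hv
  · rwa [Ne, Complex.ofReal_eq_zero, Real.sqrt_eq_zero hnonneg]

theorem re_dotProduct_mulVec_prodVec_le (M : Op ι) (ψ : ∀ j, ι j → ℂ) :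
    (star (prodVec ψ) ⬝ᵥ M *ᵥ prodVec ψ).re ≤ lambdaSq M * ∏ j, ∑ i, ‖ψ j i‖ ^ 2 := by
  have hnonneg (j) : 0 ≤ ∑ i, ‖ψ j i‖ ^ 2 := sum_nonneg fun _ _ => by positivity
  by_cases hzero : ∃ j, ∑ i, ‖ψ j i‖ ^ 2 = 0
  · obtain ⟨j, hj⟩ := hzero
    have hψj (i) : ψ j i = 0 := by
      simpa using (sum_eq_zero_iff_of_nonneg fun i _ => by positivity).mp hj i (mem_univ i)
    have hψ : prodVec ψ = 0 := funext fun a => prod_eq_zero (mem_univ j) (hψj _)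
    rw [hψ, prod_eq_zero (f := fun j => ∑ i, ‖ψ j i‖ ^ 2) (mem_univ j) hj]
    simp
  · push Not at hzero
    choose u hu hψu using fun j => exists_unit_eq_smul (hzero j)
    have hψ : prodVec ψ = ((∏ j, √(∑ i, ‖ψ j i‖ ^ 2) : ℝ) : ℂ) • prodVec u := by
      rw [Complex.ofReal_prod, ← prodVec_smul, ← funext hψu]
    have hsq : (∏ j, √(∑ i, ‖ψ j i‖ ^ 2)) * ∏ j, √(∑ i, ‖ψ j i‖ ^ 2) =
        ∏ j, ∑ i, ‖ψ j i‖ ^ 2 := by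
      simp only [← prod_mul_distrib, Real.mul_self_sqrt (hnonneg _)]
    rw [hψ, mulVec_smul, star_smul, smul_dotProduct, dotProduct_smul, smul_smul,
      Complex.star_def, Complex.conj_ofReal, smul_eq_mul, ← Complex.ofReal_mul,
      Complex.re_ofReal_mul, hsq, mul_comm, ← trace_mul_proj]
    exact mul_le_mul_of_nonneg_right (re_trace_mul_le_lambdaSq M (proj_prodVec_mem_SEP hu))
      (prod_nonneg fun j _ => hnonneg j)

theorem re_apply_self_le_lambdaSq (M : Op ι) (a : ∀ j, ι j) : (M a a).re ≤ lambdaSq M := by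
  classical
  have h := re_dotProduct_mulVec_prodVec_le M fun j => Pi.single (a j) 1
  have hnorm (j) : ∑ i, ‖(Pi.single (a j) 1 : ι j → ℂ) i‖ ^ 2 = 1 := by
    rw [sum_eq_single (a j)] <;> simp +contextual
  rw [prodVec_single, prod_eq_one fun j _ => hnorm j, mul_one] at h
  simpa [← Pi.single_star] using h

theorem mul_norm_sq_le_lambdaSq_mixture {α : Type} [Fintype α] {p : α → ℝ}
    (hp : ∀ i, 0 ≤ p i) (e : α → (∀ j, ι j) → ℂ) (i : α) (a : ∀ j, ι j) :
    p i * ‖e i a‖ ^ 2 ≤ lambdaSq (ι := ι) (mixture p e) := by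
  classical
  have hdiag : (mixture p e a a).re = ∑ i, p i * ‖e i a‖ ^ 2 := by
    simp only [mixture, proj, Matrix.sum_apply, Matrix.smul_apply, vecMulVec_apply, Pi.star_apply,
      Complex.star_def, Complex.mul_conj', smul_eq_mul, Complex.re_sum, Complex.re_ofReal_mul,
      ← Complex.ofReal_pow, Complex.ofReal_re]
  exact (single_le_sum (f := fun i => p i * ‖e i a‖ ^ 2)
    (fun i _ => mul_nonneg (hp i) (sq_nonneg _)) (mem_univ i)).trans
      (hdiag ▸ re_apply_self_le_lambdaSq _ a)

theorem lambdaSq_nonneg {M : Op ι} (hM : M.PosSemidef) : 0 ≤ lambdaSq M := by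
  refine Real.sSup_nonneg ?_
  rintro _ ⟨σ, hσ, rfl⟩
  rw [← neg_nonpos, ← Complex.neg_re, ← trace_neg, ← Matrix.neg_mul]
  refine re_trace_mul_le_of_mem_SEP (fun ψ _ => ?_) hσ
  rw [neg_mulVec, dotProduct_neg, Complex.neg_re, neg_nonpos]
  exact hM.re_dotProduct_nonneg _

theorem IsState.lambdaSq_pos {ρ : Op ι} (hρ : IsState ρ) : 0 < lambdaSq ρ := by
  have htr : ∑ a, (ρ a a).re = 1 := by
    simpa [trace] using congrArg Complex.re hρ.2
  obtain ⟨a, -, ha⟩ := exists_lt_of_sum_lt (s := univ) (f := fun _ => (0 : ℝ))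
    (g := fun a => (ρ a a).re) (by rw [sum_const_zero, htr]; exact one_pos)
  exact ha.trans_le (re_apply_self_le_lambdaSq ρ a)

end LambdaSq

section Multiplicativity

theorem norm_star_dotProduct_mulVec_le {n : Type} [Fintype n] {σ : Matrix n n ℂ}
    (hσ : σ.PosSemidef) (v w : n → ℂ) :
    ‖star v ⬝ᵥ σ *ᵥ w‖ ≤ √(star v ⬝ᵥ σ *ᵥ v).re * √(star w ⬝ᵥ σ *ᵥ w).re := by
  let := σ.toSeminormedAddCommGroup hσ
  let := σ.toInnerProductSpace hσ
  have hinner (x y : n → ℂ) : inner ℂ x y = star x ⬝ᵥ σ *ᵥ y := dotProduct_comm _ _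
  have h := norm_inner_le_norm (𝕜 := ℂ) v w
  rw [norm_eq_sqrt_re_inner (𝕜 := ℂ) v, norm_eq_sqrt_re_inner (𝕜 := ℂ) w, hinner, hinner,
    hinner] at h
  exact h

theorem re_dotProduct_mulVec_ofReal {n : Type} [Fintype n] (M : Matrix n n ℂ) (c : n → ℝ) :
    (star (fun i => (c i : ℂ)) ⬝ᵥ M *ᵥ fun i => (c i : ℂ)).re =
      ∑ a, ∑ b, (M a b).re * (c a * c b) := by
  simp only [dotProduct, mulVec, Pi.star_apply, Complex.star_def, Complex.conj_ofReal, mul_sum,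
    Complex.re_sum]
  refine sum_congr rfl fun a _ => sum_congr rfl fun b _ => ?_
  rw [Complex.re_ofReal_mul, Complex.re_mul_ofReal]
  ring

variable {N : ℕ} {ι κ : Fin N → Type}

theorem posSemidef_tensor [∀ j, Finite (ι j)] [∀ j, Finite (κ j)] {ρ : Op ι} {σ : Op κ}
    (hρ : ρ.PosSemidef) (hσ : σ.PosSemidef) : (tensor ρ σ).PosSemidef :=
  (hρ.kronecker hσ).submatrix (Equiv.arrowProdEquivProdArrow _ ι κ)

theorem tensorPow_zero (ρ : Op ι) [∀ j, DecidableEq (ι j)] : tensorPow ρ 0 = 1 := by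
  ext a b
  rw [Subsingleton.elim a b, one_apply_eq, tensorPow, of_apply, univ_eq_empty, prod_empty]

theorem tensorPow_succ (ρ : Op ι) (n : ℕ) :
    tensorPow ρ (n + 1) = (tensor ρ (tensorPow ρ n)).submatrix
      (Equiv.piCongrRight fun j => (Fin.consEquiv fun _ => ι j).symm)
      (Equiv.piCongrRight fun j => (Fin.consEquiv fun _ => ι j).symm) := by
  ext a b
  simp only [tensorPow, of_apply, Fin.prod_univ_succ]
  rfl

theorem posSemidef_tensorPow [∀ j, Finite (ι j)] {ρ : Op ι} (hρ : ρ.PosSemidef) (n : ℕ) :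
    (tensorPow ρ n).PosSemidef := by
  classical
  induction n with
  | zero => exact tensorPow_zero ρ ▸ PosSemidef.one
  | succ n ih => exact tensorPow_succ ρ n ▸ (posSemidef_tensor hρ ih).submatrix _

variable [∀ j, Fintype (ι j)] [∀ j, Fintype (κ j)]

theorem dotProduct_tensor_mulVec (ρ : Op ι) (σ : Op κ) (φ : ∀ j, ι j × κ j → ℂ) :
    star (prodVec φ) ⬝ᵥ tensor ρ σ *ᵥ prodVec φ =
      ∑ a : ∀ j, ι j, ∑ b : ∀ j, ι j, ρ a b *
        (star (prodVec fun j k => φ j (a j, k)) ⬝ᵥ σ *ᵥ prodVec fun j k => φ j (b j, k)) := by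
  simp only [dotProduct, mulVec]
  rw [← (Equiv.arrowProdEquivProdArrow _ ι κ).symm.sum_comp, Fintype.sum_prod_type]
  refine sum_congr rfl fun a _ => ?_
  simp only [mul_sum]
  conv_rhs => rw [sum_comm]
  refine sum_congr rfl fun a' _ => ?_
  rw [← (Equiv.arrowProdEquivProdArrow _ ι κ).symm.sum_comp, Fintype.sum_prod_type]
  refine sum_congr rfl fun b _ => sum_congr rfl fun b' _ => ?_
  simp only [Equiv.arrowProdEquivProdArrow, Equiv.coe_fn_symm_mk, tensor, of_apply, prodVec,
    Pi.star_apply]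
  ring

theorem norm_dotProduct_mulVec_prodVec_le {σ : Op κ} (hσ : σ.PosSemidef) (ψ φ : ∀ j, κ j → ℂ) :
    ‖star (prodVec ψ) ⬝ᵥ σ *ᵥ prodVec φ‖ ≤
      lambdaSq σ * ((∏ j, √(∑ k, ‖ψ j k‖ ^ 2)) * ∏ j, √(∑ k, ‖φ j k‖ ^ 2)) := by
  have hsqrt (χ : ∀ j, κ j → ℂ) : √(star (prodVec χ) ⬝ᵥ σ *ᵥ prodVec χ).re ≤
      √(lambdaSq σ) * ∏ j, √(∑ k, ‖χ j k‖ ^ 2) := by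
    refine (Real.sqrt_le_sqrt (re_dotProduct_mulVec_prodVec_le σ χ)).trans_eq ?_
    rw [Real.sqrt_mul (lambdaSq_nonneg hσ), Real.sqrt_prod _ fun j _ => by positivity]
  calc ‖star (prodVec ψ) ⬝ᵥ σ *ᵥ prodVec φ‖
      ≤ _ := norm_star_dotProduct_mulVec_le hσ _ _
    _ ≤ (√(lambdaSq σ) * ∏ j, √(∑ k, ‖ψ j k‖ ^ 2)) *
          (√(lambdaSq σ) * ∏ j, √(∑ k, ‖φ j k‖ ^ 2)) := by
        gcongr <;> exact hsqrt _
    _ = _ := by rw [mul_mul_mul_comm, Real.mul_self_sqrt (lambdaSq_nonneg hσ)]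

theorem lambdaSq_tensor_le {ρ M : Op ι} (hM : ∀ a b, ‖ρ a b‖ ≤ (M a b).re) {σ : Op κ}
    (hσ : σ.PosSemidef) (hM0 : 0 ≤ lambdaSq M) :
    lambdaSq (tensor ρ σ) ≤ lambdaSq M * lambdaSq σ := by
  have hσ0 := lambdaSq_nonneg hσ
  refine lambdaSq_le (mul_nonneg hM0 hσ0) fun φ hφ => ?_
  set c : ∀ j, ι j → ℝ := fun j i => √(∑ k, ‖φ j (i, k)‖ ^ 2) with hc
  have hc1 (j) : ∑ i, ‖(c j i : ℂ)‖ ^ 2 = 1 := by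
    simp only [hc, Complex.norm_real, Real.norm_eq_abs, sq_abs, ← hφ j, Fintype.sum_prod_type]
    exact sum_congr rfl fun i _ => Real.sq_sqrt (by positivity)
  rw [dotProduct_tensor_mulVec]
  refine (Complex.re_le_norm _).trans ?_
  calc ‖∑ a : ∀ j, ι j, ∑ b : ∀ j, ι j, ρ a b *
        (star (prodVec fun j k => φ j (a j, k)) ⬝ᵥ σ *ᵥ prodVec fun j k => φ j (b j, k))‖
      ≤ ∑ a : ∀ j, ι j, ∑ b : ∀ j, ι j, (M a b).re *
          (lambdaSq σ * ((∏ j, c j (a j)) * ∏ j, c j (b j))) := by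
        refine norm_sum_le_of_le _ fun a _ => norm_sum_le_of_le _ fun b _ => ?_
        rw [norm_mul]
        exact mul_le_mul (hM a b) (norm_dotProduct_mulVec_prodVec_le hσ _ _) (norm_nonneg _)
          ((norm_nonneg _).trans (hM a b))
    _ = (∑ a : ∀ j, ι j, ∑ b : ∀ j, ι j, (M a b).re *
          ((∏ j, c j (a j)) * ∏ j, c j (b j))) * lambdaSq σ := by
        simp only [sum_mul]
        exact sum_congr rfl fun a _ => sum_congr rfl fun b _ => by ring
    _ = (star (prodVec fun j i => (c j i : ℂ)) ⬝ᵥ M *ᵥ prodVec fun j i => (c j i : ℂ)).re *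
          lambdaSq σ := by
        have hprod : (prodVec fun j i => (c j i : ℂ)) = fun a => ((∏ j, c j (a j) : ℝ) : ℂ) :=
          funext fun a => (Complex.ofReal_prod _ _).symm
        rw [hprod, re_dotProduct_mulVec_ofReal]
    _ ≤ lambdaSq M * lambdaSq σ := by
        gcongr
        simpa only [hc1, prod_const_one, mul_one] using
          re_dotProduct_mulVec_prodVec_le M fun j i => (c j i : ℂ)

theorem dotProduct_tensor_mulVec_prodVec_mul (ρ : Op ι) (σ : Op κ) (ψ : ∀ j, ι j → ℂ)
    (φ : ∀ j, κ j → ℂ) :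
    star (prodVec fun j i => ψ j i.1 * φ j i.2) ⬝ᵥ
        tensor ρ σ *ᵥ prodVec (fun j i => ψ j i.1 * φ j i.2) =
      (star (prodVec ψ) ⬝ᵥ ρ *ᵥ prodVec ψ) * (star (prodVec φ) ⬝ᵥ σ *ᵥ prodVec φ) := by
  have hsplit (a : ∀ j, ι j) : prodVec (fun j k => ψ j (a j) * φ j k) = prodVec ψ a • prodVec φ :=
    prodVec_smul _ _
  simp only [dotProduct_tensor_mulVec, hsplit, star_smul, smul_dotProduct, mulVec_smul,
    dotProduct_smul, smul_eq_mul]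
  generalize star (prodVec φ) ⬝ᵥ σ *ᵥ prodVec φ = z
  simp only [dotProduct, mulVec, Pi.star_apply, mul_sum, sum_mul]
  exact sum_congr rfl fun a _ => sum_congr rfl fun b _ => by ring

theorem lambdaSq_mul_le_lambdaSq_tensor {ρ : Op ι} {σ : Op κ} (hρ : ρ.PosSemidef)
    (hσ : σ.PosSemidef) : lambdaSq ρ * lambdaSq σ ≤ lambdaSq (tensor ρ σ) := by
  have h0 := lambdaSq_nonneg (posSemidef_tensor hρ hσ)
  refine lambdaSq_mul_le (lambdaSq_nonneg hσ) h0 fun ψ hψ => ?_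
  rw [mul_comm]
  refine lambdaSq_mul_le (hρ.re_dotProduct_nonneg _) h0 fun φ hφ => ?_
  have hunit (j) : ∑ i : ι j × κ j, ‖ψ j i.1 * φ j i.2‖ ^ 2 = 1 := by
    simp only [norm_mul, mul_pow, Fintype.sum_prod_type, ← mul_sum, hφ j, mul_one, hψ j]
  have h := re_dotProduct_mulVec_prodVec_le (tensor ρ σ) fun j i => ψ j i.1 * φ j i.2
  rwa [prod_eq_one fun j _ => hunit j, mul_one, dotProduct_tensor_mulVec_prodVec_mul,
    Complex.mul_re, ← Complex.le_def.mp (hρ.dotProduct_mulVec_nonneg (prodVec ψ)) |>.2,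
    Complex.zero_im, zero_mul, sub_zero, mul_comm] at h

theorem lambdaSq_tensor {ρ M : Op ι} (hρ : ρ.PosSemidef) (hM : ∀ a b, ‖ρ a b‖ ≤ (M a b).re)
    (hMρ : lambdaSq M = lambdaSq ρ) {σ : Op κ} (hσ : σ.PosSemidef) :
    lambdaSq (tensor ρ σ) = lambdaSq ρ * lambdaSq σ :=
  (hMρ ▸ lambdaSq_tensor_le hM hσ (hMρ ▸ lambdaSq_nonneg hρ)).antisymm
    (lambdaSq_mul_le_lambdaSq_tensor hρ hσ)

theorem lambdaSq_submatrix_le {M : Op κ} (hM : M.PosSemidef) (e : ∀ j, ι j ≃ κ j) :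
    lambdaSq (M.submatrix (Equiv.piCongrRight e) (Equiv.piCongrRight e)) ≤ lambdaSq M := by
  refine lambdaSq_le (lambdaSq_nonneg hM) fun ψ hψ => ?_
  have hnorm (j) : ∑ k, ‖ψ j ((e j).symm k)‖ ^ 2 = 1 := by
    rw [(e j).symm.sum_comp fun i => ‖ψ j i‖ ^ 2, hψ j]
  have h := re_dotProduct_mulVec_prodVec_le M fun j k => ψ j ((e j).symm k)
  rw [prod_eq_one fun j _ => hnorm j, mul_one] at h
  rw [submatrix_mulVec_equiv, ← comp_equiv_symm_dotProduct]
  exact h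

theorem lambdaSq_submatrix {M : Op κ} (hM : M.PosSemidef) (e : ∀ j, ι j ≃ κ j) :
    lambdaSq (M.submatrix (Equiv.piCongrRight e) (Equiv.piCongrRight e)) = lambdaSq M := by
  refine (lambdaSq_submatrix_le hM e).antisymm ?_
  have h := lambdaSq_submatrix_le (hM.submatrix (Equiv.piCongrRight e)) fun j => (e j).symm
  have hcancel : Equiv.piCongrRight e ∘ Equiv.piCongrRight (fun j => (e j).symm) = id :=
    (Equiv.piCongrRight e).self_comp_symm
  rwa [submatrix_submatrix, hcancel, submatrix_id_id] at h

theorem lambdaSq_tensorPow_zero (ρ : Op ι) : lambdaSq (tensorPow ρ 0) = 1 := by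
  classical
  refine le_antisymm (lambdaSq_le zero_le_one fun ψ hψ => ?_) ?_
  · rw [tensorPow_zero, one_mulVec, star_prodVec_dotProduct,
      prod_eq_one fun j _ => star_dotProduct_self_eq_one_iff.mpr (hψ j), Complex.one_re]
  · simpa only [tensorPow_zero, one_apply_eq, Complex.one_re] using
      re_apply_self_le_lambdaSq (tensorPow ρ 0) fun _ => Fin.elim0

theorem lambdaSq_tensorPow {ρ M : Op ι} (hρ : ρ.PosSemidef) (hM : ∀ a b, ‖ρ a b‖ ≤ (M a b).re)
    (hMρ : lambdaSq M = lambdaSq ρ) (n : ℕ) : lambdaSq (tensorPow ρ n) = lambdaSq ρ ^ n := by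
  induction n with
  | zero => rw [lambdaSq_tensorPow_zero, pow_zero]
  | succ n ih =>
    have hn := posSemidef_tensorPow hρ n
    rw [tensorPow_succ, lambdaSq_submatrix (posSemidef_tensor hρ hn),
      lambdaSq_tensor hρ hM hMρ hn, ih, pow_succ']

end Multiplicativity

section Functionals

variable {N : ℕ} {ι : Fin N → Type} [∀ j, Fintype (ι j)] [∀ j, DecidableEq (ι j)]

theorem GM_eq {ρ : Op ι} (hρ : 0 ≤ lambdaSq ρ) :
    GM N ι ρ = ((-Real.logb 2 (lambdaSq ρ) : ℝ) : EReal) := by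
  rw [GM, Real.logb, Real.logb, Real.log_sqrt hρ]
  congr 1
  ring

theorem hasRegularization_of_eq_mul {E : Functional N} {ρ : Op ι} {L : ℝ}
    (hE : ∀ n, E (fun j => Fin n → ι j) (tensorPow ρ n) = ((n * L : ℝ) : EReal)) :
    HasRegularization E ρ (L : EReal) := by
  refine tendsto_const_nhds.congr' ?_
  filter_upwards [Filter.eventually_ne_atTop 0] with n hn
  rw [hE, ← EReal.coe_div, mul_div_cancel_left₀ _ (Nat.cast_ne_zero.mpr hn)]

variable {ρ M : Op ι}

theorem isStrongAdditive_GM (hρ : IsState ρ) (hM : ∀ a b, ‖ρ a b‖ ≤ (M a b).re)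
    (hMρ : lambdaSq M = lambdaSq ρ) : IsStrongAdditive (GM N) ρ := by
  intro κ _ _ σ hσ
  rw [GM_eq (lambdaSq_nonneg (posSemidef_tensor hρ.1 hσ.1)), GM_eq hρ.lambdaSq_pos.le,
    GM_eq hσ.lambdaSq_pos.le, lambdaSq_tensor hρ.1 hM hMρ hσ.1,
    Real.logb_mul hρ.lambdaSq_pos.ne' hσ.lambdaSq_pos.ne', neg_add, EReal.coe_add]

theorem hasRegularization_GM (hρ : ρ.PosSemidef) (hM : ∀ a b, ‖ρ a b‖ ≤ (M a b).re)
    (hMρ : lambdaSq M = lambdaSq ρ) :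
    HasRegularization (GM N) ρ ((-Real.logb 2 (lambdaSq ρ) : ℝ) : EReal) :=
  hasRegularization_of_eq_mul fun n => by
    rw [GM_eq (lambdaSq_nonneg (posSemidef_tensorPow hρ n)), lambdaSq_tensorPow hρ hM hMρ,
      Real.logb_pow, mul_neg]

end Functionals

section TensorPower

theorem sum_prod_mul_sum {κ : Type} [Fintype κ] {p : κ → ℝ} (hp1 : ∑ i, p i = 1) (f : κ → ℝ)
    (n : ℕ) : ∑ c : Fin n → κ, (∏ m, p (c m)) * ∑ m, f (c m) = n * ∑ i, p i * f i := by
  induction n with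
  | zero => simp
  | succ n ih =>
    have hone : ∑ c : Fin n → κ, ∏ m, p (c m) = 1 := by rw [← Fintype.sum_pow, hp1, one_pow]
    rw [← (Fin.consEquiv fun _ => κ).sum_comp, Fintype.sum_prod_type]
    simp only [Fin.consEquiv_apply, Fin.prod_univ_succ, Fin.sum_univ_succ, Fin.cons_zero,
      Fin.cons_succ]
    calc ∑ i, ∑ c : Fin n → κ, p i * (∏ m, p (c m)) * (f i + ∑ m, f (c m))
        = ∑ i, (p i * f i * ∑ c : Fin n → κ, ∏ m, p (c m)) +
            ∑ i, (p i * ∑ c : Fin n → κ, (∏ m, p (c m)) * ∑ m, f (c m)) := by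
          rw [← sum_add_distrib]
          refine sum_congr rfl fun i _ => ?_
          rw [mul_sum, mul_sum, ← sum_add_distrib]
          exact sum_congr rfl fun c _ => by ring
      _ = (n + 1 : ℕ) * ∑ i, p i * f i := by
          simp only [ih, hone, mul_one, ← sum_mul, hp1]
          push_cast
          ring

variable {N n : ℕ} {ι : Fin N → Type} {κ : Type}

/-- The product vector `⨂ m, v m` of `n` vectors of an `N`-partite system. The `j`-th party holds
the `j`-th parties of all factors, as in `tensorPow`. -/
def tensorVec (v : Fin n → (∀ j, ι j) → ℂ) : (∀ j, Fin n → ι j) → ℂ :=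
  fun a => ∏ m, v m fun j => a j m

theorem tensorVec_smul (c : Fin n → ℂ) (v : Fin n → (∀ j, ι j) → ℂ) :
    tensorVec (fun m => c m • v m) = (∏ m, c m) • tensorVec v := by
  ext a
  simp only [tensorVec, Pi.smul_apply, smul_eq_mul, prod_mul_distrib]

theorem tensorVec_prodVec (ψ : Fin n → ∀ j, ι j → ℂ) :
    tensorVec (fun m => prodVec (ψ m)) = prodVec fun j a => ∏ m, ψ m j (a m) :=
  funext fun _ => prod_comm

theorem tensorPow_mixture [Fintype κ] (p : κ → ℝ) (e : κ → (∀ j, ι j) → ℂ) (n : ℕ) :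
    tensorPow (mixture p e) n =
      mixture (fun c : Fin n → κ => ∏ m, p (c m)) fun c => tensorVec fun m => e (c m) := by
  ext a b
  simp only [tensorPow, mixture, proj, tensorVec, of_apply, Matrix.sum_apply, Matrix.smul_apply,
    vecMulVec_apply, Pi.star_apply, star_prod, prod_univ_sum, Fintype.piFinset_univ,
    prod_mul_distrib, smul_eq_mul, Complex.ofReal_prod]

variable [∀ j, Fintype (ι j)]

theorem sum_prod_copies {R : Type} [CommSemiring R] (f : Fin n → (∀ j, ι j) → R) :
    ∑ a : ∀ j, Fin n → ι j, ∏ m, f m (fun j => a j m) = ∏ m, ∑ b, f m b := by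
  classical
  rw [prod_univ_sum, Fintype.piFinset_univ,
    ← (Equiv.piComm fun (j : Fin N) (_ : Fin n) => ι j).sum_comp]
  rfl

theorem star_tensorVec_dotProduct (v w : Fin n → (∀ j, ι j) → ℂ) :
    star (tensorVec v) ⬝ᵥ tensorVec w = ∏ m, star (v m) ⬝ᵥ w m := by
  simp only [dotProduct, ← sum_prod_copies, tensorVec, Pi.star_apply, star_prod, prod_mul_distrib]

theorem tensorPow_mulVec_tensorVec (A : Op ι) (v : Fin n → (∀ j, ι j) → ℂ) :
    tensorPow A n *ᵥ tensorVec v = tensorVec fun m => A *ᵥ v m := by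
  ext a
  simp only [mulVec, dotProduct, tensorPow, tensorVec, of_apply, ← prod_mul_distrib]
  exact sum_prod_copies fun m b => A (fun j => a j m) b * v m b

theorem orthonormal_tensorVec {e : κ → (∀ j, ι j) → ℂ}
    (he : Orthonormal ℂ fun i => WithLp.toLp 2 (e i)) :
    Orthonormal ℂ fun c : Fin n → κ => WithLp.toLp 2 (tensorVec fun m => e (c m)) := by
  classical
  rw [orthonormal_toLp_iff] at he ⊢
  intro c d
  simp only [star_tensorVec_dotProduct, he, prod_ite_zero, prod_const_one, mem_univ, forall_const,
    funext_iff]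

theorem tensorPow_mem_SEP {σ : Op ι} (hσ : σ ∈ SEP ι) (n : ℕ) :
    tensorPow σ n ∈ SEP fun j => Fin n → ι j := by
  classical
  rw [SEP_eq_convexHull_proj, mem_convexHull_iff_exists_fintype] at hσ
  obtain ⟨κ, _, p, z, hp, hp1, hz, rfl⟩ := hσ
  choose ψ hψ hzψ using hz
  have hmix : ∑ i, p i • z i = mixture p fun i => prodVec (ψ i) := by
    simp only [hzψ]; rfl
  rw [hmix, tensorPow_mixture]
  refine mixture_mem_of_convex (convex_convexHull ℝ _) (fun c => prod_nonneg fun m _ => hp _)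
    (by rw [← Fintype.sum_pow, hp1, one_pow]) fun c => ?_
  rw [tensorVec_prodVec]
  refine proj_prodVec_mem_SEP fun j => ?_
  simp only [norm_prod, ← prod_pow]
  rw [← Fintype.piFinset_univ, ← prod_univ_sum (fun _ => univ) fun m i => ‖ψ (c m) j i‖ ^ 2]
  exact prod_eq_one fun m _ => hψ _ j

end TensorPower

section RelativeEntropyOfEntanglement

variable {N : ℕ} {ι : Fin N → Type} {κ : Type} [∀ j, Fintype (ι j)] [∀ j, DecidableEq (ι j)]
  [Fintype κ]

theorem REE_mixture_eq {e : κ → (∀ j, ι j) → ℂ}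
    (he : Orthonormal ℂ fun i => WithLp.toLp 2 (e i)) {w s : κ → ℝ} (hw : ∀ i, 0 < w i)
    (hs : ∀ i, 0 ≤ s i) (hws : ∑ i, w i * s i = 1) {σ : Op ι} (hσ : σ ∈ SEP ι)
    (hσe : ∀ i, σ *ᵥ e i = (s i : ℂ) • e i) (hw1 : lambdaSq (mixture w e) ≤ 1) :
    REE N ι (mixture (fun i => w i * s i) e) =
      ((∑ i, w i * s i * Real.logb 2 (w i) : ℝ) : EReal) := by
  have hp (i) : 0 ≤ w i * s i := mul_nonneg (hw i).le (hs i)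
  apply le_antisymm
  · refine (iInf₂_le σ hσ).trans_eq ?_
    rw [relEntropy_mixture_of_eigenvectors he hp (posSemidef_of_mem_SEP hσ).isHermitian hσe
      fun i hi => by rw [hi, mul_zero]]
    congr 1
    refine sum_congr rfl fun i _ => ?_
    rcases (hs i).eq_or_lt with hi | hi
    · rw [← hi, mul_zero, zero_mul, zero_mul]
    · rw [Real.logb_mul (hw i).ne' hi.ne', add_sub_cancel_right]
  · refine le_iInf₂ fun τ hτ => ?_
    exact sum_mul_logb_le_relEntropy he hp hws hw (posSemidef_of_mem_SEP hτ)
      ((re_trace_mul_le_lambdaSq _ hτ).trans hw1)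

theorem REE_tensorPow_mixture_eq {e : κ → (∀ j, ι j) → ℂ}
    (he : Orthonormal ℂ fun i => WithLp.toLp 2 (e i)) {w s : κ → ℝ} (hw : ∀ i, 0 < w i)
    (hs : ∀ i, 0 ≤ s i) (hws : ∑ i, w i * s i = 1) {σ : Op ι} (hσ : σ ∈ SEP ι)
    (hσe : ∀ i, σ *ᵥ e i = (s i : ℂ) • e i) {n : ℕ}
    (hw1 : lambdaSq (tensorPow (mixture w e) n) ≤ 1) :
    REE N _ (tensorPow (mixture (fun i => w i * s i) e) n) =
      ((n * ∑ i, w i * s i * Real.logb 2 (w i) : ℝ) : EReal) := by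
  rw [tensorPow_mixture] at hw1 ⊢
  simp only [prod_mul_distrib]
  rw [REE_mixture_eq (orthonormal_tensorVec he) (fun c => prod_pos fun m _ => hw _)
    (fun c => prod_nonneg fun m _ => hs _) ?_ (tensorPow_mem_SEP hσ n) (fun c => ?_) hw1]
  · simp only [← prod_mul_distrib, Real.logb_prod _ _ fun _ _ => (hw _).ne',
      sum_prod_mul_sum hws fun i => Real.logb 2 (w i)]
  · simp only [← prod_mul_distrib]
    rw [← Fintype.sum_pow fun i => w i * s i, hws, one_pow]
  · simp only [tensorPow_mulVec_tensorVec, hσe, tensorVec_smul, Complex.ofReal_prod]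

theorem hasRegularization_REE_mixture {e : κ → (∀ j, ι j) → ℂ}
    (he : Orthonormal ℂ fun i => WithLp.toLp 2 (e i)) {w s : κ → ℝ} (hw : ∀ i, 0 < w i)
    (hs : ∀ i, 0 ≤ s i) (hws : ∑ i, w i * s i = 1) {σ : Op ι} (hσ : σ ∈ SEP ι)
    (hσe : ∀ i, σ *ᵥ e i = (s i : ℂ) • e i) {M : Op ι}
    (hM : ∀ a b, ‖mixture w e a b‖ ≤ (M a b).re) (hMw : lambdaSq M = lambdaSq (mixture w e))
    (hw1 : lambdaSq (mixture w e) ≤ 1) :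
    HasRegularization (REE N) (mixture (fun i => w i * s i) e)
      ((∑ i, w i * s i * Real.logb 2 (w i) : ℝ) : EReal) := by
  have hpsd := posSemidef_mixture (fun i => (hw i).le) e
  refine hasRegularization_of_eq_mul fun n => REE_tensorPow_mixture_eq he hw hs hws hσ hσe ?_
  rw [lambdaSq_tensorPow hpsd hM hMw]
  exact pow_le_one₀ (lambdaSq_nonneg hpsd) hw1

end RelativeEntropyOfEntanglement

section BitStrings

variable {N : ℕ}

/-- The bit string with value `1 - b` on `S` and `b` elsewhere. With `b = 0, 1` the sets `∅` and
`{k}` give the bit strings of `|b…b⟩` and of `|u_k⟩`, `|v_k⟩`. -/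
def flipBits (S : Finset (Fin N)) (b : Fin 2) : Fin N → Fin 2 :=
  fun j => if j ∈ S then b.rev else b

theorem flipBits_empty (b : Fin 2) : flipBits (∅ : Finset (Fin N)) b = fun _ => b :=
  funext fun _ => if_neg (notMem_empty _)

theorem flipBits_inj {S T : Finset (Fin N)} (h : #(S ∪ T) < N) {b c : Fin 2} :
    flipBits S b = flipBits T c ↔ S = T ∧ b = c := by
  refine ⟨fun hST => ?_, fun ⟨hS, hb⟩ => hS ▸ hb ▸ rfl⟩
  obtain ⟨j, hj⟩ : ∃ j, j ∉ S ∪ T := by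
    by_contra! hall
    rw [eq_univ_of_forall hall, card_univ, Fintype.card_fin] at h
    exact h.false
  rw [mem_union, not_or] at hj
  obtain rfl : b = c := by
    simpa only [flipBits, if_neg hj.1, if_neg hj.2] using congrFun hST j
  have hrev : b.rev ≠ b := by fin_cases b <;> decide
  refine ⟨ext fun i => ?_, rfl⟩
  have hi := congrFun hST i
  by_cases hS : i ∈ S <;> by_cases hT : i ∈ T <;>
    simp_all [flipBits, hrev.symm]

theorem flipBits_empty_zero_ne_one (hN : 0 < N) :
    flipBits (∅ : Finset (Fin N)) 0 ≠ flipBits ∅ 1 := by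
  rw [Ne, flipBits_inj (by simpa)]
  simp

theorem flipBits_injective_of_card {κ : Type} {S : κ → Finset (Fin N)}
    (hS : Function.Injective S) (hcard : ∀ i j, #(S i ∪ S j) < N) :
    Function.Injective fun i : κ × Fin 2 => flipBits (S i.1) i.2 := fun i j hij => by
  obtain ⟨hSij, hb⟩ := (flipBits_inj (hcard i.1 j.1)).mp hij
  exact Prod.ext (hS hSij) hb

theorem card_toFinset_union_le (i j : Option (Fin N)) : #(i.toFinset ∪ j.toFinset) ≤ 2 := by
  refine (card_union_le _ _).trans ?_
  cases i <;> cases j <;> simp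

theorem option_toFinset_injective :
    Function.Injective (Option.toFinset : Option (Fin N) → Finset (Fin N)) := fun i j h =>
  Option.ext fun k => by
    simpa only [Option.mem_toFinset, Option.mem_def] using Finset.ext_iff.mp h k

theorem flipBits_toFinset_injective (hN : 2 < N) :
    Function.Injective fun i : Option (Fin N) × Fin 2 => flipBits i.1.toFinset i.2 :=
  flipBits_injective_of_card option_toFinset_injective
    fun i j => (card_toFinset_union_le i j).trans_lt hN

theorem flipBits_elim_injective (hN : 3 < N) {T : Finset (Fin N)} (hT : #T = 2) :
    Function.Injective fun i : Option (Option (Fin N)) × Fin 2 =>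
      flipBits (i.1.elim T Option.toFinset) i.2 := by
  have hcard (o : Option (Fin N)) : #o.toFinset ≤ 1 := by cases o <;> simp
  have hne (o : Option (Fin N)) : T ≠ o.toFinset := fun h => by
    have := h ▸ hcard o
    omega
  have hlt (o : Option (Fin N)) : #(T ∪ o.toFinset) < N := by
    have := card_union_le T o.toFinset
    have := hcard o
    omega
  refine flipBits_injective_of_card
    (S := fun o : Option (Option (Fin N)) => o.elim T Option.toFinset) ?_ ?_
  · rintro (_ | i) (_ | j) h
    · rfl
    · exact absurd h (hne j)
    · exact absurd h.symm (hne i)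
    · exact congrArg some (option_toFinset_injective h)
  · rintro (_ | i) (_ | j)
    · simp only [Option.elim, union_self]; omega
    · exact hlt j
    · exact union_comm T _ ▸ hlt i
    · exact (card_toFinset_union_le i j).trans_lt (by omega)

theorem prod_flipBits_mul {R : Type} [CommMonoid R] (f : Fin N → Fin 2 → R) (S : Finset (Fin N)) :
    (∏ j, f j (flipBits S 0 j)) * ∏ j, f j (flipBits S 1 j) = ∏ j, f j 0 * f j 1 := by
  rw [← prod_mul_distrib]
  refine prod_congr rfl fun j _ => ?_
  by_cases hj : j ∈ S
  · simp only [flipBits, if_pos hj]; exact mul_comm _ _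
  · simp only [flipBits, if_neg hj]

theorem sum_norm_sq_prodVec {ι : Fin N → Type} [∀ j, Fintype (ι j)] {ψ : ∀ j, ι j → ℂ}
    (hψ : ∀ j, ∑ i, ‖ψ j i‖ ^ 2 = 1) : ∑ a, ‖prodVec ψ a‖ ^ 2 = 1 := by
  rw [← star_dotProduct_self_eq_one_iff, star_prodVec_dotProduct]
  exact prod_eq_one fun j _ => star_dotProduct_self_eq_one_iff.mpr (hψ j)

theorem sq_add_sum_norm_sq_flipBits_le (hN : 3 < N) {ψ : Fin N → Fin 2 → ℂ}
    (hψ : ∀ j, ∑ i, ‖ψ j i‖ ^ 2 = 1) :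
    (‖prodVec ψ (flipBits ∅ 0)‖ + ‖prodVec ψ (flipBits ∅ 1)‖) ^ 2 +
      ∑ k, ∑ b, ‖prodVec ψ (flipBits {k} b)‖ ^ 2 ≤ 1 := by
  set f : Finset (Fin N) → Fin 2 → ℝ := fun S b => ‖prodVec ψ (flipBits S b)‖
  obtain ⟨T, hT⟩ : ∃ T : Finset (Fin N), #T = 2 :=
    (exists_subset_card_eq (s := univ) (n := 2) (by rw [card_univ, Fintype.card_fin]; omega)).imp
      fun _ h => h.2
  have hsum : (∑ b, f T b ^ 2) + ((∑ b, f ∅ b ^ 2) + ∑ k, ∑ b, f {k} b ^ 2) ≤ 1 := by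
    have h := sum_le_univ_sum_of_nonneg (s := univ.map ⟨_, flipBits_elim_injective hN hT⟩)
      fun a => sq_nonneg ‖prodVec ψ a‖
    rw [sum_norm_sq_prodVec hψ, sum_map, Fintype.sum_prod_type, Fintype.sum_option,
      Fintype.sum_option] at h
    exact h
  have hswap : f ∅ 0 * f ∅ 1 = f T 0 * f T 1 := by
    simp only [f, ← norm_mul, prodVec, prod_flipBits_mul ψ]
  have hAMGM := two_mul_le_add_sq (f T 0) (f T 1)
  change (f ∅ 0 + f ∅ 1) ^ 2 + ∑ k, ∑ b, f {k} b ^ 2 ≤ 1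
  simp only [Fin.sum_univ_two] at hsum ⊢
  linarith [add_sq (f ∅ 0) (f ∅ 1)]

end BitStrings

section DurStates

variable {N : ℕ}

theorem star_ket_dotProduct (a : Fin N → Fin 2) (v : (Fin N → Fin 2) → ℂ) :
    star (ket a) ⬝ᵥ v = v a := by
  rw [ket, ← Pi.single_star, star_one, single_one_dotProduct]

theorem orthonormal_ket {κ : Type} {f : κ → Fin N → Fin 2} (hf : Function.Injective f) :
    Orthonormal ℂ fun i => WithLp.toLp 2 (ket (f i)) := by
  classical
  refine orthonormal_toLp_iff.mpr fun i j => ?_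
  rw [star_ket_dotProduct, ket, Pi.single_apply]
  simp only [hf.eq_iff]

theorem ghz_eq_flipBits (α : ℝ) : ghz N α = ((1 / √2 : ℝ) : ℂ) •
    (ket (flipBits ∅ 0) + Complex.exp (α * Complex.I) • ket (flipBits ∅ 1)) := by
  simp only [flipBits_empty, ghz]

theorem uVec_eq_ket_flipBits (k : Fin N) : uVec k = ket (flipBits {k} 0) := by
  rw [uVec]
  congr 1
  ext j
  simp [flipBits, Function.update_apply]

theorem vVec_eq_ket_flipBits (k : Fin N) : vVec k = ket (flipBits {k} 1) := by
  rw [vVec]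
  congr 1
  ext j
  simp [flipBits, Function.update_apply]

/-- The eigenvectors of Dür's states: `|Ψ_G⟩` at `none`, and `|u_k⟩`, `|v_k⟩` at `some (k, 0)`,
`some (k, 1)`. -/
noncomputable def durVec (N : ℕ) (α : ℝ) : Option (Fin N × Fin 2) → (Fin N → Fin 2) → ℂ
  | none => ghz N α
  | some (k, b) => ket (flipBits {k} b)

/-- The weight `A` on `|Ψ_G⟩` and `C` on each of the vectors `|u_k⟩`, `|v_k⟩`. -/
def durWeight (A C : ℝ) : Option (Fin N × Fin 2) → ℝ
  | none => A
  | some _ => C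

/-- The operator `A |Ψ_G⟩⟨Ψ_G| + C ∑ₖ (|u_k⟩⟨u_k| + |v_k⟩⟨v_k|)`. It specializes to Dür's states
and to the witness used to bound their relative entropy of entanglement from below. -/
noncomputable def durOp (N : ℕ) (α A C : ℝ) : Op fun _ : Fin N => Fin 2 :=
  mixture (durWeight A C) (durVec N α)

theorem durState_eq_durOp (α x : ℝ) : durState N α x = durOp N α x ((1 - x) / (2 * N)) := by
  rw [durState, durOp, mixture, Fintype.sum_option, Fintype.sum_prod_type]
  simp only [durVec, durWeight, Fin.sum_univ_two, uVec_eq_ket_flipBits, vVec_eq_ket_flipBits,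
    smul_sum, smul_add]

theorem durWeight_nonneg {A C : ℝ} (hA : 0 ≤ A) (hC : 0 ≤ C) (i : Option (Fin N × Fin 2)) :
    0 ≤ durWeight A C i := by
  cases i <;> assumption

theorem sum_durWeight_mul (A C : ℝ) (f : Option (Fin N × Fin 2) → ℝ) :
    ∑ i, durWeight A C i * f i = A * f none + C * ∑ i, f (some i) := by
  rw [Fintype.sum_option, mul_sum]
  rfl

theorem norm_sq_one_div_sqrt_two : ‖((1 / √2 : ℝ) : ℂ)‖ ^ 2 = 1 / 2 := by
  rw [Complex.norm_real, Real.norm_eq_abs, sq_abs, div_pow, one_pow, Real.sq_sqrt zero_le_two]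

theorem orthonormal_durVec (hN : 2 < N) (α : ℝ) :
    Orthonormal ℂ fun i => WithLp.toLp 2 (durVec N α i) := by
  set e : Option (Fin N) → Fin 2 → (Fin N → Fin 2) → ℂ := fun o b => ket (flipBits o.toFinset b)
  set c : ℂ := ((1 / √2 : ℝ) : ℂ)
  set z : ℂ := Complex.exp (α * Complex.I)
  have he (o b o' b') : star (e o b) ⬝ᵥ e o' b' = if (o, b) = (o', b') then 1 else 0 :=
    orthonormal_toLp_iff.mp (orthonormal_ket (flipBits_toFinset_injective hN)) (o, b) (o', b')
  have hnone : durVec N α none = c • (e none 0 + z • e none 1) := ghz_eq_flipBits α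
  have hsome (k b) : durVec N α (some (k, b)) = e (some k) b := rfl
  have hc : starRingEnd ℂ c * c = 1 / 2 := by
    rw [Complex.conj_mul', ← Complex.ofReal_pow, norm_sq_one_div_sqrt_two]
    norm_num
  have hz : starRingEnd ℂ z * z = 1 := by
    rw [Complex.conj_mul', Complex.norm_exp_ofReal_mul_I, Complex.ofReal_one, one_pow]
  refine orthonormal_toLp_iff.mpr ?_
  rintro (_ | ⟨k, b⟩) (_ | ⟨l, d⟩)
  · simp only [hnone, smul_add, star_add, star_smul, RCLike.star_def, dotProduct_add,
      dotProduct_smul, add_dotProduct, smul_dotProduct, he, if_true, smul_eq_mul, mul_one,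
      Prod.mk.injEq, one_ne_zero, zero_ne_one, and_false, if_false, mul_zero, add_zero, zero_add]
    linear_combination (1 + z * starRingEnd ℂ z) * hc + 1 / 2 * hz
  · simp [hnone, hsome, he]
  · simp [hnone, hsome, he]
  · simp [hsome, he]

theorem norm_sq_star_ghz_dotProduct_le (α : ℝ) (v : (Fin N → Fin 2) → ℂ) :
    ‖star (ghz N α) ⬝ᵥ v‖ ^ 2 ≤ (‖v (flipBits ∅ 0)‖ + ‖v (flipBits ∅ 1)‖) ^ 2 / 2 := by
  rw [ghz_eq_flipBits, star_smul, smul_dotProduct, star_add, add_dotProduct, star_smul,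
    smul_dotProduct, star_ket_dotProduct, star_ket_dotProduct, norm_smul, norm_star, mul_pow,
    norm_sq_one_div_sqrt_two, div_mul_eq_mul_div, one_mul]
  gcongr
  refine (norm_add_le _ _).trans_eq ?_
  rw [norm_smul, norm_star, Complex.norm_exp_ofReal_mul_I, one_mul]

theorem lambdaSq_durOp_le (hN : 3 < N) (α : ℝ) {A C : ℝ} (hC : 0 ≤ C) :
    lambdaSq (durOp N α A C) ≤ max (A / 2) C := by
  refine lambdaSq_le (hC.trans (le_max_right _ _)) fun ψ hψ => ?_
  rw [durOp, dotProduct_mixture_mulVec, Complex.ofReal_re, sum_durWeight_mul]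
  have hghz := norm_sq_star_ghz_dotProduct_le α (prodVec ψ)
  have hsum := sq_add_sum_norm_sq_flipBits_le hN hψ
  simp only [Fintype.sum_prod_type, durVec, star_ket_dotProduct]
  set g := ‖star (ghz N α) ⬝ᵥ prodVec ψ‖ ^ 2
  set h := ∑ k, ∑ b, ‖prodVec ψ (flipBits {k} b)‖ ^ 2
  have : 0 ≤ g := sq_nonneg _
  have : 0 ≤ h := sum_nonneg fun _ _ => sum_nonneg fun _ _ => sq_nonneg _
  calc A * g + C * h = A / 2 * (2 * g) + C * h := by ring
    _ ≤ max (A / 2) C * (2 * g) + max (A / 2) C * h := by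
        gcongr
        exacts [le_max_left _ _, le_max_right _ _]
    _ = max (A / 2) C * (2 * g + h) := by ring
    _ ≤ max (A / 2) C := mul_le_of_le_one_right (hC.trans (le_max_right _ _)) (by linarith)

theorem norm_ghz_zero (hN : 0 < N) (α : ℝ) : ‖ghz N α (flipBits ∅ 0)‖ ^ 2 = 1 / 2 := by
  have hne := flipBits_empty_zero_ne_one hN
  rw [ghz_eq_flipBits]
  simp [ket, hne]

theorem ghz_zero_apply (hN : 0 < N) (α : ℝ) (a : Fin N → Fin 2) :
    ghz N 0 a = (‖ghz N α a‖ : ℂ) := by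
  have hne := flipBits_empty_zero_ne_one hN
  rw [ghz_eq_flipBits, ghz_eq_flipBits]
  simp only [ket, Pi.single_apply, Pi.smul_apply, Pi.add_apply, smul_eq_mul]
  split_ifs <;> simp_all [abs_of_nonneg (Real.sqrt_nonneg 2)]

theorem posSemidef_durOp (α : ℝ) {A C : ℝ} (hA : 0 ≤ A) (hC : 0 ≤ C) :
    (durOp N α A C).PosSemidef :=
  posSemidef_mixture (durWeight_nonneg hA hC) _

theorem lambdaSq_durOp (hN : 3 < N) (α : ℝ) {A C : ℝ} (hA : 0 ≤ A) (hC : 0 ≤ C) :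
    lambdaSq (durOp N α A C) = max (A / 2) C := by
  have hle : ∀ i a, durWeight A C i * ‖durVec N α i a‖ ^ 2 ≤ lambdaSq (durOp N α A C) :=
    mul_norm_sq_le_lambdaSq_mixture (durWeight_nonneg hA hC) (durVec N α)
  refine (lambdaSq_durOp_le hN α hC).antisymm (max_le ?_ ?_)
  · simpa [durWeight, durVec, norm_ghz_zero (by omega : 0 < N), div_eq_mul_inv] using
      hle none (flipBits ∅ 0)
  · let k : Fin N := ⟨0, by omega⟩
    simpa [durWeight, durVec, ket] using hle (some (k, 0)) (flipBits {k} 0)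

theorem norm_durOp_apply_le (hN : 0 < N) (α : ℝ) {A C : ℝ} (hA : 0 ≤ A) (hC : 0 ≤ C)
    (a b : Fin N → Fin 2) : ‖durOp N α A C a b‖ ≤ (durOp N 0 A C a b).re := by
  refine norm_mixture_apply_le (durWeight_nonneg hA hC) ?_ a b
  rintro (_ | ⟨k, b⟩) a
  · exact ghz_zero_apply hN α a
  · simp only [durVec, ket, Pi.single_apply]
    split_ifs <;> simp

/-- The diagonal part of `durOp N α A C` in the computational basis, written as a mixture of the
vectors `|b…b⟩` at `(none, b)` and `|u_k⟩`, `|v_k⟩` at `(some k, b)`. -/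
noncomputable def dephasedDurOp (N : ℕ) (A C : ℝ) : Op fun _ : Fin N => Fin 2 :=
  mixture (fun i : Option (Fin N) × Fin 2 => i.1.elim (A / 2) fun _ => C)
    fun i => ket (flipBits i.1.toFinset i.2)

theorem proj_ket_mem_SEP (a : Fin N → Fin 2) : proj (ket a) ∈ SEP fun _ : Fin N => Fin 2 := by
  rw [ket, ← prodVec_single]
  refine proj_prodVec_mem_SEP fun j => ?_
  rw [sum_eq_single (a j)] <;> simp +contextual

theorem dephasedDurOp_mem_SEP {A C : ℝ} (hA : 0 ≤ A) (hC : 0 ≤ C) (h1 : A + 2 * N * C = 1) :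
    dephasedDurOp N A C ∈ SEP fun _ : Fin N => Fin 2 := by
  refine mixture_mem_of_convex (convex_convexHull ℝ _) ?_ ?_ fun i => proj_ket_mem_SEP _
  · rintro ⟨_ | _, _⟩
    exacts [div_nonneg hA zero_le_two, hC]
  · simp only [Fintype.sum_prod_type, sum_const, card_univ, Fintype.card_fin, nsmul_eq_mul,
      Nat.cast_ofNat, Fintype.sum_option, Option.elim_none, Option.elim_some, ← h1]
    ring

theorem dephasedDurOp_mulVec_durVec (hN : 2 < N) (α A C : ℝ) (i : Option (Fin N × Fin 2)) :
    dephasedDurOp N A C *ᵥ durVec N α i = (durWeight (A / 2) C i : ℂ) • durVec N α i := by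
  have h := mixture_mulVec_self (orthonormal_ket (flipBits_toFinset_injective hN))
    fun i => i.1.elim (A / 2) fun _ => C
  obtain _ | ⟨k, b⟩ := i
  · have hket (b) : dephasedDurOp N A C *ᵥ ket (flipBits ∅ b) =
        ((A / 2 : ℝ) : ℂ) • ket (flipBits ∅ b) := h (none, b)
    simp only [durVec, durWeight, ghz_eq_flipBits, mulVec_smul, mulVec_add, hket]
    module
  · exact h (some k, b)

theorem durWeight_witness_mul (A C : ℝ) (i : Option (Fin N × Fin 2)) :
    durWeight 2 1 i * durWeight (A / 2) C i = durWeight A C i := by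
  cases i
  exacts [mul_div_cancel₀ A two_ne_zero, one_mul C]

theorem sum_durWeight (A C : ℝ) :
    ∑ i : Option (Fin N × Fin 2), durWeight A C i = A + 2 * N * C := by
  simpa [mul_comm C, mul_comm (N : ℝ)] using sum_durWeight_mul (N := N) A C fun _ => 1

theorem sum_durWeight_mul_logb_witness (A C : ℝ) :
    ∑ i : Option (Fin N × Fin 2), durWeight A C i * Real.logb 2 (durWeight 2 1 i) = A := by
  simp [durWeight]

theorem durWeight_witness_pos (i : Option (Fin N × Fin 2)) : 0 < durWeight 2 1 i := by
  cases i
  exacts [two_pos, one_pos]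

theorem lambdaSq_witness (hN : 3 < N) (α : ℝ) : lambdaSq (durOp N α 2 1) = 1 := by
  rw [lambdaSq_durOp hN α zero_le_two zero_le_one, div_self two_ne_zero, max_self]

theorem REE_durOp (hN : 3 < N) (α : ℝ) {A C : ℝ} (hA : 0 ≤ A) (hC : 0 ≤ C)
    (h1 : A + 2 * N * C = 1) : REE N _ (durOp N α A C) = A := by
  have h := REE_mixture_eq (orthonormal_durVec (by omega) α) durWeight_witness_pos
    (durWeight_nonneg (div_nonneg hA zero_le_two) hC)
    (by simp only [durWeight_witness_mul, sum_durWeight, h1])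
    (dephasedDurOp_mem_SEP hA hC h1) (dephasedDurOp_mulVec_durVec (by omega) α A C)
    (lambdaSq_witness hN α).le
  simpa only [durOp, durWeight_witness_mul, sum_durWeight_mul_logb_witness] using h

theorem hasRegularization_REE_durOp (hN : 3 < N) (α : ℝ) {A C : ℝ} (hA : 0 ≤ A) (hC : 0 ≤ C)
    (h1 : A + 2 * N * C = 1) : HasRegularization (REE N) (durOp N α A C) A := by
  have h := hasRegularization_REE_mixture (orthonormal_durVec (by omega) α) durWeight_witness_pos
    (durWeight_nonneg (div_nonneg hA zero_le_two) hC)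
    (by simp only [durWeight_witness_mul, sum_durWeight, h1])
    (dephasedDurOp_mem_SEP hA hC h1) (dephasedDurOp_mulVec_durVec (by omega) α A C)
    (norm_durOp_apply_le (by omega) α zero_le_two zero_le_one)
    ((lambdaSq_witness hN 0).trans (lambdaSq_witness hN α).symm) (lambdaSq_witness hN α).le
  simpa only [durOp, durWeight_witness_mul, sum_durWeight_mul_logb_witness] using h

theorem isState_durOp (hN : 2 < N) (α : ℝ) {A C : ℝ} (hA : 0 ≤ A) (hC : 0 ≤ C)
    (h1 : A + 2 * N * C = 1) : IsState (durOp N α A C) :=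
  isState_mixture (durWeight_nonneg hA hC) (by rw [sum_durWeight, h1]) fun i =>
    (orthonormal_toLp_iff.mp (orthonormal_durVec hN α) i i).trans (if_pos rfl)

theorem isStrongAdditive_GM_durOp (hN : 3 < N) (α : ℝ) {A C : ℝ} (hA : 0 ≤ A) (hC : 0 ≤ C)
    (h1 : A + 2 * N * C = 1) : IsStrongAdditive (GM N) (durOp N α A C) :=
  isStrongAdditive_GM (isState_durOp (by omega) α hA hC h1) (norm_durOp_apply_le (by omega) α hA hC)
    ((lambdaSq_durOp hN 0 hA hC).trans (lambdaSq_durOp hN α hA hC).symm)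

theorem GM_durOp (hN : 3 < N) (α : ℝ) {A C : ℝ} (hA : 0 ≤ A) (hC : 0 ≤ C) :
    GM N _ (durOp N α A C) = ((-Real.logb 2 (max (A / 2) C) : ℝ) : EReal) := by
  rw [GM_eq (lambdaSq_nonneg (posSemidef_durOp α hA hC)), lambdaSq_durOp hN α hA hC]

theorem hasRegularization_GM_durOp (hN : 3 < N) (α : ℝ) {A C : ℝ} (hA : 0 ≤ A) (hC : 0 ≤ C) :
    HasRegularization (GM N) (durOp N α A C) ((-Real.logb 2 (max (A / 2) C) : ℝ) : EReal) := by
  rw [← lambdaSq_durOp hN α hA hC]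
  exact hasRegularization_GM (posSemidef_durOp α hA hC) (norm_durOp_apply_le (by omega) α hA hC)
    ((lambdaSq_durOp hN 0 hA hC).trans (lambdaSq_durOp hN α hA hC).symm)

theorem half_le_div_two_mul {N x : ℝ} (hN : 0 < N) (h : x ≤ 1 / (N + 1)) :
    x / 2 ≤ (1 - x) / (2 * N) := by
  rw [le_div_iff₀ (by positivity)] at h
  rw [div_le_div_iff₀ two_pos (by positivity)]
  linarith

theorem div_two_mul_le_half {N x : ℝ} (hN : 0 < N) (h : 1 / (N + 1) ≤ x) :
    (1 - x) / (2 * N) ≤ x / 2 := by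
  rw [div_le_iff₀ (by positivity)] at h
  rw [div_le_div_iff₀ (by positivity) two_pos]
  linarith

end DurStates

end MultipartiteEntanglement

theorem mainTheorem11 (N : ℕ) (hN : 4 ≤ N) (α x : ℝ) (hx0 : 0 ≤ x) (hx1 : x ≤ 1) :
    MultipartiteEntanglement.IsStrongAdditive (MultipartiteEntanglement.GM N)
        (MultipartiteEntanglement.durState N α x) ∧
      (x ≤ 1 / ((N : ℝ) + 1) →
        MultipartiteEntanglement.GM N _ (MultipartiteEntanglement.durState N α x) =
            ((-Real.logb 2 ((1 - x) / (2 * (N : ℝ))) : ℝ) : EReal) ∧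
          MultipartiteEntanglement.HasRegularization (MultipartiteEntanglement.GM N)
            (MultipartiteEntanglement.durState N α x)
            ((-Real.logb 2 ((1 - x) / (2 * (N : ℝ))) : ℝ) : EReal)) ∧
      (1 / ((N : ℝ) + 1) ≤ x →
        MultipartiteEntanglement.GM N _ (MultipartiteEntanglement.durState N α x) =
            ((-Real.logb 2 (x / 2) : ℝ) : EReal) ∧
          MultipartiteEntanglement.HasRegularization (MultipartiteEntanglement.GM N)
            (MultipartiteEntanglement.durState N α x)
            ((-Real.logb 2 (x / 2) : ℝ) : EReal)) ∧
      MultipartiteEntanglement.IsAdditive (MultipartiteEntanglement.REE N)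
        (MultipartiteEntanglement.durState N α x) ∧
      MultipartiteEntanglement.REE N _ (MultipartiteEntanglement.durState N α x) =
        (x : EReal) ∧
      MultipartiteEntanglement.HasRegularization (MultipartiteEntanglement.REE N)
        (MultipartiteEntanglement.durState N α x) (x : EReal) := by
  open MultipartiteEntanglement in
  have hN0 : (0 : ℝ) < N := Nat.cast_pos.mpr (by omega)
  have hC : 0 ≤ (1 - x) / (2 * N) := div_nonneg (sub_nonneg.mpr hx1) (by positivity)
  have htrace : x + 2 * N * ((1 - x) / (2 * N)) = 1 := by
    rw [mul_div_cancel₀ _ (by positivity), add_sub_cancel]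
  have hGM := GM_durOp hN α hx0 hC
  have hGMreg := hasRegularization_GM_durOp hN α hx0 hC
  have hREE := REE_durOp hN α hx0 hC htrace
  have hREEreg := hasRegularization_REE_durOp hN α hx0 hC htrace
  rw [durState_eq_durOp]
  refine ⟨isStrongAdditive_GM_durOp hN α hx0 hC htrace, fun h => ?_, fun h => ?_, ?_, hREE, hREEreg⟩
  · rw [max_eq_right (half_le_div_two_mul hN0 h)] at hGM hGMreg
    exact ⟨hGM, hGMreg⟩
  · rw [max_eq_left (div_two_mul_le_half hN0 h)] at hGM hGMreg
    exact ⟨hGM, hGMreg⟩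
  · rwa [IsAdditive, hREE]
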